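/- Let $P$ be a simple polygon: the closed region of the plane bounded by a simple closed polygonal chain with $n\ge 3$ vertices. Two points $x,y$ are visible from each other if the segment $xy$ lies in $P$; a point $z$ is weakly visible from an edge $e$ if $z$ is visible from some point of $e$, and a set is weakly visible from $e$ if all its points are. A set $G$ of edges of $P$ is optimal for the edge guard problem if every point of $P$ is weakly visible from some edge in $G$ and no set of fewer edges has this property. A visibility region is a maximal connected subset $R$ of $P$ all of whose points are visible from the same set $M_R$ of vertices of $P$. Two distinct visibility regions are neighboring if their boundaries have a nondegenerate segment in common. The dual graph has an arc from $R$ to a neighboring region $R'$ whenever $M_{R'}\subsetneq M_R$. A VG-sink is a visibility region with no outgoing arc in the dual graph. Then a set $G$ of edges is optimal for the edge guard problem in $P$ if and only if it is a set of minimum cardinality among the sets $G$ of edges such that every VG-sink is weakly visible from some edge in $G$. Moreover, if no three vertices of $P$ are collinear, then the same equivalence holds with VG-sinks understood as the visibility regions $s$ such that $M_s\subsetneq M_q$ for every neighboring visibility region $q$. -/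

import Mathlib

namespace EdgeGuard

/-- The Euclidean plane. -/
abbrev Plane := EuclideanSpace ℝ (Fin 2)

/-- The closed polygonal chain through the vertices of `Q` (with edges
`Q i — Q (i + 1)`, indices cyclic) is simple: there are at least three vertices, they are
distinct, consecutive edges meet only in their common endpoint, and other edges are disjoint. -/
structure IsSimple {n : ℕ} (Q : Polygon Plane n) : Prop where
  three_le : 3 ≤ n
  injective : Function.Injective Q.vertices
  adjacent : ∀ i : Fin n,
    Q.edgeSet ℝ i ∩ Q.edgeSet ℝ (finRotate n i) = {Q (finRotate n i)}
  nonadjacent : ∀ i j : Fin n, j ≠ i → j ≠ finRotate n i → i ≠ finRotate n j →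
    Disjoint (Q.edgeSet ℝ i) (Q.edgeSet ℝ j)

/-- The closed region bounded by the polygon: the boundary chain together with the points of
its complement that lie in a bounded connected component of the complement. -/
def region {n : ℕ} (Q : Polygon Plane n) : Set Plane :=
  Q.boundary ℝ ∪ {x | x ∉ Q.boundary ℝ ∧
    Bornology.IsBounded (connectedComponentIn (Q.boundary ℝ)ᶜ x)}

/-- Two points are mutually visible if all their convex combinations lie in the polygon. -/
def Visible {n : ℕ} (Q : Polygon Plane n) (x y : Plane) : Prop :=
  segment ℝ x y ⊆ region Q

/-- The point `z` is weakly visible from the edge with index `e`. -/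
def WeaklyVisible {n : ℕ} (Q : Polygon Plane n) (z : Plane) (e : Fin n) : Prop :=
  ∃ u ∈ Q.edgeSet ℝ e, Visible Q z u

/-- Every point of `S` is weakly visible from the edge with index `e`. -/
def SetWeaklyVisible {n : ℕ} (Q : Polygon Plane n) (S : Set Plane) (e : Fin n) : Prop :=
  ∀ z ∈ S, WeaklyVisible Q z e

/-- The (indices of the) vertices of the polygon visible from `x`. -/
def visibleVertices {n : ℕ} (Q : Polygon Plane n) (x : Plane) : Set (Fin n) :=
  {i | Visible Q x (Q i)}

/-- `R` is a connected (nonempty) subset of the polygon all of whose points are visible from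
the same vertices. -/
def IsUniform {n : ℕ} (Q : Polygon Plane n) (R : Set Plane) : Prop :=
  R ⊆ region Q ∧ IsConnected R ∧
    ∀ x ∈ R, ∀ y ∈ R, visibleVertices Q x = visibleVertices Q y

/-- A visibility region: a maximal connected subset of the polygon all of whose points are
visible from the same vertices. -/
def IsVisibilityRegion {n : ℕ} (Q : Polygon Plane n) (R : Set Plane) : Prop :=
  Maximal (IsUniform Q) R

/-- The visibility set `M_R`: the (indices of the) vertices visible from `R`. -/
def visibilitySet {n : ℕ} (Q : Polygon Plane n) (R : Set Plane) : Set (Fin n) :=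
  {i | ∀ x ∈ R, Visible Q x (Q i)}

/-- Two distinct visibility regions are neighboring if their boundaries have a nondegenerate
segment in common. -/
def Neighboring {n : ℕ} (Q : Polygon Plane n) (R R' : Set Plane) : Prop :=
  IsVisibilityRegion Q R ∧ IsVisibilityRegion Q R' ∧ R ≠ R' ∧
    ∃ a b : Plane, a ≠ b ∧ segment ℝ a b ⊆ frontier R ∩ frontier R'

/-- The arcs of the dual graph: neighboring regions are joined by an arc towards the region
with the smaller visibility set. -/
def DualArc {n : ℕ} (Q : Polygon Plane n) (R R' : Set Plane) : Prop :=
  Neighboring Q R R' ∧ visibilitySet Q R' ⊂ visibilitySet Q R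

/-- A sink of the dual graph: a visibility region without outgoing arcs. -/
def IsDualSink {n : ℕ} (Q : Polygon Plane n) (s : Set Plane) : Prop :=
  IsVisibilityRegion Q s ∧ ∀ q : Set Plane, ¬ DualArc Q s q

/-- A sink in the strict sense: a visibility region whose visibility set is strictly contained
in the visibility set of every neighboring region. -/
def IsStrictSink {n : ℕ} (Q : Polygon Plane n) (s : Set Plane) : Prop :=
  IsVisibilityRegion Q s ∧
    ∀ q : Set Plane, Neighboring Q s q → visibilitySet Q s ⊂ visibilitySet Q q

/-- No three vertices are collinear. -/
def NoThreeCollinear {n : ℕ} (Q : Polygon Plane n) : Prop :=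
  ∀ i j k : Fin n, i ≠ j → j ≠ k → i ≠ k → ¬ Collinear ℝ {Q i, Q j, Q k}

/-- Every point of the polygon is weakly visible from some edge in `G`. -/
def GuardsPolygon {n : ℕ} (Q : Polygon Plane n) (G : Finset (Fin n)) : Prop :=
  ∀ z ∈ region Q, ∃ e ∈ G, WeaklyVisible Q z e

/-- Every set with the property `Sink` is weakly visible from some edge in `G`. -/
def CoversSinks {n : ℕ} (Q : Polygon Plane n) (Sink : Set Plane → Prop)
    (G : Finset (Fin n)) : Prop :=
  ∀ s : Set Plane, Sink s → ∃ e ∈ G, SetWeaklyVisible Q s e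

/-- `G` has the property `C`, with the least possible number of elements. -/
def IsMinimum {n : ℕ} (C : Finset (Fin n) → Prop) (G : Finset (Fin n)) : Prop :=
  C G ∧ ∀ H : Finset (Fin n), C H → G.card ≤ H.card

/-- `G` is an optimal solution of the edge guard problem. -/
def IsOptimalEdgeGuardSet {n : ℕ} (Q : Polygon Plane n) (G : Finset (Fin n)) : Prop :=
  IsMinimum (GuardsPolygon Q) G

end EdgeGuard

/-!
# Guarding a simple polygon amounts to guarding the sinks of its visibility regions

Everything rests on a local monotonicity principle for weak visibility. Fix a point `p` of the
polygon that is not a vertex, and an edge `e`. If `z` and `z'` are points of the polygon close to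
`p`, if `z` sees every vertex that `z'` sees, and if `z'` sees a point of `e`, then `z` sees a point
of `e` (`PolygonalSet.eventually_sees_edge_mono`); if `z' = p`, the point `p` may be a vertex as well
(`PolygonalSet.eventually_sees_edge`). Two consequences follow.

* Weak visibility from `e` is locally constant on a visibility region, hence constant
  (`IsSimple.weaklyVisible_of_mem`). So guards of the whole polygon cover each region by one edge.
* If `R'` is a neighbor of `R` that sees fewer vertices, then an edge covering `R'` covers `R`:
  compare points of `R` and `R'` close to a common boundary point that is not a vertex
  (`IsSimple.setWeaklyVisible_of_dualArc`). As visibility sets are finite, following arcs leads from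
  any region to a sink, so an edge set covering all sinks guards the polygon
  (`IsSimple.guardsPolygon_iff`).

For the monotonicity, let `p` see the point `u` of `e` and let `ℓ` be the line `p u`. Close to the
segment `p u` all vertices lie on `ℓ`, so sight lines can be turned freely as long as they stay on one
side of `ℓ`. If `z` does not see `u`, its view along the segment `p u` ends in a vertex `v`. By
hypothesis `z'` sees no vertex of the segment beyond `v`, although it sees points of `e` close to
`u`; a discussion of where the sight line from `z'` to `e` crosses `ℓ` shows that either the ray from
`z` through `v` reaches `e`, or `z` sees `u` after all (`PolygonalSet.sees_of_frame`). The argument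
uses four properties of the polygon, collected in `PolygonalSet`: it is locally star-shaped; it
contains every triangle whose sides it contains; only vertices obstruct a sight line that is being
turned; and a line through a vertex is obstructed there from one side at most, as only two edges
meet there. All of them are read off from the definition of the region through components of the
complement of the boundary, without the Jordan curve theorem.

If no three vertices are collinear, close to a generic point of the common boundary of two
neighboring regions the visibility of one vertex only can change, and it is lost on one side only.
So neighboring regions have strictly comparable visibility sets (`IsSimple.ssubset_or_ssubset`), and
the two notions of sink agree.
-/

namespace EdgeGuard
open Set Filter Topology

/-! ### Affine functionals on the plane -/

/-- The affine functional `x ↦ det (d, x - o)`: for `d ≠ 0` it vanishes exactly on the line through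
`o` with direction `d`, and its sign tells the two sides of this line apart. -/
def sideMap (o d : Plane) : Plane →ᵃ[ℝ] ℝ where
  toFun x := d 0 * (x 1 - o 1) - d 1 * (x 0 - o 0)
  linear :=
    { toFun := fun x => d 0 * x 1 - d 1 * x 0
      map_add' := fun x y => by simp only [PiLp.add_apply]; ring
      map_smul' := fun c x => by simp only [PiLp.smul_apply, smul_eq_mul, RingHom.id_apply]; ring }
  map_vadd' := fun x v => by
    simp only [vadd_eq_add, PiLp.add_apply, LinearMap.coe_mk, AddHom.coe_mk]; ring

theorem sideMap_apply (o d x : Plane) :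
    sideMap o d x = d 0 * (x 1 - o 1) - d 1 * (x 0 - o 0) := rfl

theorem plane_ext {x y : Plane} (h0 : x 0 = y 0) (h1 : x 1 = y 1) : x = y := by
  ext i; fin_cases i <;> assumption

theorem eq_add_smul_of_sideMap_eq_zero {o d x : Plane} (hd : d ≠ 0) (h : sideMap o d x = 0) :
    ∃ t : ℝ, x = o + t • d := by
  rw [sideMap_apply] at h
  have hpos : 0 < d 0 ^ 2 + d 1 ^ 2 := by
    by_contra hc
    apply hd
    have h0 : d 0 = 0 := by nlinarith [sq_nonneg (d 0), sq_nonneg (d 1)]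
    have h1 : d 1 = 0 := by nlinarith [sq_nonneg (d 0), sq_nonneg (d 1)]
    exact plane_ext (by simpa using h0) (by simpa using h1)
  refine ⟨(d 0 * (x 0 - o 0) + d 1 * (x 1 - o 1)) / (d 0 ^ 2 + d 1 ^ 2), ?_⟩
  apply plane_ext
  · simp only [PiLp.add_apply, PiLp.smul_apply, smul_eq_mul]
    field_simp
    linear_combination d 1 * (-h)
  · simp only [PiLp.add_apply, PiLp.smul_apply, smul_eq_mul]
    field_simp
    linear_combination d 0 * h

theorem sideMap_self (o d : Plane) : sideMap o d o = 0 := by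
  simp [sideMap_apply]

theorem sideMap_sub_self (a b : Plane) : sideMap a (b - a) b = 0 := by
  simp only [sideMap_apply, PiLp.sub_apply]; ring

/-- A point on the line through `a ≠ b` is given by a parameter. -/
theorem exists_lineMap_of_sideMap_eq_zero {a b x : Plane} (hab : a ≠ b)
    (h : sideMap a (b - a) x = 0) : ∃ t : ℝ, x = AffineMap.lineMap a b t := by
  obtain ⟨t, ht⟩ := eq_add_smul_of_sideMap_eq_zero (sub_ne_zero.2 hab.symm) h
  exact ⟨t, by rw [ht, AffineMap.lineMap_apply_module']; abel⟩

/-- Affine functionals are continuous. -/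
theorem continuous_functional (φ : Plane →ᵃ[ℝ] ℝ) : Continuous φ :=
  φ.continuous_of_finiteDimensional

theorem map_lineMap (φ : Plane →ᵃ[ℝ] ℝ) (a b : Plane) (t : ℝ) :
    φ (AffineMap.lineMap a b t) = (1 - t) * φ a + t * φ b := by
  rw [AffineMap.apply_lineMap, AffineMap.lineMap_apply_module]; simp

theorem mem_segment_iff_lineMap {a b x : Plane} :
    x ∈ segment ℝ a b ↔ ∃ t : ℝ, 0 ≤ t ∧ t ≤ 1 ∧ x = AffineMap.lineMap a b t := by
  rw [segment_eq_image_lineMap]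
  constructor
  · rintro ⟨t, ⟨h0, h1⟩, rfl⟩; exact ⟨t, h0, h1, rfl⟩
  · rintro ⟨t, h0, h1, rfl⟩; exact ⟨t, ⟨h0, h1⟩, rfl⟩

theorem lineMap_mem_segment (a b : Plane) {t : ℝ} (h0 : 0 ≤ t) (h1 : t ≤ 1) :
    AffineMap.lineMap a b t ∈ segment ℝ a b :=
  mem_segment_iff_lineMap.2 ⟨t, h0, h1, rfl⟩

theorem segment_subset_segment {a b x y : Plane} (hx : x ∈ segment ℝ a b)
    (hy : y ∈ segment ℝ a b) : segment ℝ x y ⊆ segment ℝ a b :=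
  (convex_segment a b).segment_subset hx hy

/-- Splitting a segment at one of its points. -/
theorem segment_subset_union {a b x : Plane} (hx : x ∈ segment ℝ a b) :
    segment ℝ a b ⊆ segment ℝ a x ∪ segment ℝ x b := by
  obtain ⟨t, h0, h1, rfl⟩ := mem_segment_iff_lineMap.1 hx
  intro y hy
  obtain ⟨s, hs0, hs1, rfl⟩ := mem_segment_iff_lineMap.1 hy
  rcases le_total s t with h | h
  · left
    rcases eq_or_lt_of_le h0 with rfl | ht
    · have : s = 0 := le_antisymm h hs0
      subst this; simp
    · refine mem_segment_iff_lineMap.2 ⟨s / t, by positivity, (div_le_one ht).2 h, ?_⟩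
      rw [AffineMap.lineMap_lineMap_right, div_mul_cancel₀ _ ht.ne']
  · right
    rcases eq_or_lt_of_le h1 with rfl | ht
    · have : s = 1 := le_antisymm hs1 h
      subst this; simp
    · have h1t : 0 < 1 - t := by linarith
      refine mem_segment_iff_lineMap.2 ⟨(s - t) / (1 - t), div_nonneg (by linarith) h1t.le,
        (div_le_one h1t).2 (by linarith), ?_⟩
      rw [AffineMap.lineMap_lineMap_left]
      congr 1
      field_simp
      ring

theorem eventually_lineMap_mem {a b : Plane} {U : Set Plane} (hU : U ∈ 𝓝 a) :
    ∀ᶠ t : ℝ in 𝓝[>] 0, AffineMap.lineMap a b t ∈ U := by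
  have hc : Continuous fun t : ℝ => (AffineMap.lineMap a b t : Plane) :=
    AffineMap.lineMap_continuous
  have : Tendsto (fun t : ℝ => (AffineMap.lineMap a b t : Plane)) (𝓝 0) (𝓝 a) := by
    simpa using hc.tendsto 0
  exact (this.mono_left nhdsWithin_le_nhds) hU

theorem eventually_pos_lt_one : ∀ᶠ t : ℝ in 𝓝[>] 0, 0 < t ∧ t < 1 := by
  have h1 : ∀ᶠ t : ℝ in 𝓝[>] 0, t < 1 := nhdsWithin_le_nhds (Iio_mem_nhds one_pos)
  exact (eventually_mem_nhdsWithin (a := (0:ℝ)) (s := Ioi 0)).and h1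

/-- A nonzero affine functional vanishing at two points vanishes only on the line through them. -/
theorem exists_lineMap_of_eq_zero {φ : Plane →ᵃ[ℝ] ℝ} {c u q x : Plane} (hcu : c ≠ u)
    (hc : φ c = 0) (hu : φ u = 0) (hq : φ q ≠ 0) (hx : φ x = 0) :
    ∃ t : ℝ, x = AffineMap.lineMap c u t := by
  apply exists_lineMap_of_sideMap_eq_zero hcu
  by_contra hne
  -- otherwise `c, u, x` are affinely independent and `φ` vanishes identically
  have hd : u - c ≠ 0 := sub_ne_zero.2 hcu.symm
  set ψ := sideMap c (u - c) with hψ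
  let k := ψ q / ψ x
  have h0 : ψ (q + k • (c - x)) = 0 := by
    have h2 := sideMap_apply c (u - c) q
    have h3 := sideMap_apply c (u - c) x
    have h4 := sideMap_apply c (u - c) (q + k • (c - x))
    rw [← hψ] at h2 h3 h4
    have h5 : k * ψ x = ψ q := div_mul_cancel₀ _ hne
    rw [h4]
    simp only [PiLp.add_apply, PiLp.smul_apply, PiLp.sub_apply, smul_eq_mul] at *
    linear_combination -h5 - h2 + k * h3
  obtain ⟨t, ht⟩ := eq_add_smul_of_sideMap_eq_zero hd h0
  have hq' : q = (k • (x - c) + t • (u - c)) +ᵥ c := by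
    have : q = (q + k • (c - x)) + k • (x - c) := by
      rw [add_assoc, ← smul_add]; simp
    rw [this, ht, vadd_eq_add]; abel
  have e2 : φ.linear (x - c) = φ x - φ c := by simpa using φ.linearMap_vsub x c
  have e3 : φ.linear (u - c) = φ u - φ c := by simpa using φ.linearMap_vsub u c
  apply hq
  rw [hq', AffineMap.map_vadd, map_add, map_smul, map_smul, e2, e3, hc, hu, hx]
  simp

/-- Points of the line `c u` close to an inner point of the segment `c u` lie in the segment. -/
theorem eventually_mem_segment {c u v : Plane} (hcu : c ≠ u) (hv : v ∈ openSegment ℝ c u) :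
    ∀ᶠ x in 𝓝 v, (∃ t : ℝ, x = AffineMap.lineMap c u t) → x ∈ segment ℝ c u := by
  obtain ⟨τ, ⟨hτ0, hτ1⟩, hτ⟩ : ∃ τ : ℝ, τ ∈ Ioo (0:ℝ) 1 ∧ AffineMap.lineMap c u τ = v := by
    rw [openSegment_eq_image_lineMap] at hv
    exact hv
  let f : Plane → ℝ := fun x => inner ℝ (u - c) (x - c)
  have hfc : Continuous f := by fun_prop
  have hn : 0 < ‖u - c‖ ^ 2 := by
    have := norm_pos_iff.2 (sub_ne_zero.2 hcu.symm); positivity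
  have hfl : ∀ t : ℝ, f (AffineMap.lineMap c u t) = t * ‖u - c‖ ^ 2 := by
    intro t
    simp only [f]
    rw [AffineMap.lineMap_apply_module', add_sub_cancel_right, inner_smul_right,
      real_inner_self_eq_norm_sq]
  have hfv : f v = τ * ‖u - c‖ ^ 2 := by rw [← hτ, hfl]
  have ev1 : ∀ᶠ x in 𝓝 v, 0 < f x :=
    hfc.continuousAt.eventually (lt_mem_nhds (by rw [hfv]; positivity))
  have ev2 : ∀ᶠ x in 𝓝 v, f x < ‖u - c‖ ^ 2 :=
    hfc.continuousAt.eventually (gt_mem_nhds (by rw [hfv]; nlinarith))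
  filter_upwards [ev1, ev2] with x h1 h2
  rintro ⟨t, rfl⟩
  rw [hfl] at h1 h2
  refine lineMap_mem_segment _ _ ?_ ?_
  · by_contra h; push Not at h; nlinarith
  · by_contra h; push Not at h; nlinarith

/-- If `v` lies strictly between `c` and `u` and `q` is strictly on the positive side of the line
`cu`, then the triangle `c q u` contains all points of the closed positive side close to `v`. -/
theorem eventually_mem_triangle {φ : Plane →ᵃ[ℝ] ℝ} {c u q v : Plane} (hc : φ c = 0)
    (hu : φ u = 0) (hq : 0 < φ q) (hcu : c ≠ u) (hv : v ∈ openSegment ℝ c u) :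
    ∀ᶠ x in 𝓝 v, 0 ≤ φ x → x ∈ convexHull ℝ {c, q, u} := by
  obtain ⟨τ, ⟨hτ0, hτ1⟩, hτ⟩ : ∃ τ : ℝ, τ ∈ Ioo (0:ℝ) 1 ∧ AffineMap.lineMap c u τ = v := by
    rw [openSegment_eq_image_lineMap] at hv
    exact hv
  have hcont := continuous_functional φ
  have hφv : φ v = 0 := by rw [← hτ, map_lineMap, hc, hu]; ring
  -- the projection from `q` to the line
  let β : Plane → ℝ := fun x => φ x / φ q
  let pr : Plane → Plane := fun x => (1 - β x)⁻¹ • (x - β x • q)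
  have hβ : Continuous β := hcont.div_const _
  have hβv : β v = 0 := by simp [β, hφv]
  have hprc : ContinuousAt pr v := by
    have h1 : ContinuousAt (fun x => (1 - β x)⁻¹) v :=
      (continuousAt_const.sub hβ.continuousAt).inv₀ (by simp [hβv])
    have h2 : ContinuousAt (fun x => x - β x • q) v :=
      continuousAt_id.sub (hβ.continuousAt.smul continuousAt_const)
    exact h1.smul h2
  have hprv : pr v = v := by simp [pr, hβv]
  have ev1 := hprc.eventually (hprv.symm ▸ eventually_mem_segment hcu hv)
  have ev3 : ∀ᶠ x in 𝓝 v, β x < 1 := hβ.continuousAt.eventually (gt_mem_nhds (by rw [hβv]; norm_num))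
  filter_upwards [ev1, ev3] with x h1 h3 hx
  have hβ0 : 0 ≤ β x := div_nonneg hx hq.le
  have hx' : x = AffineMap.lineMap (pr x) q (β x) := by
    rw [AffineMap.lineMap_apply_module]
    simp only [pr]
    rw [smul_smul, mul_inv_cancel₀ (by linarith), one_smul]; abel
  have hpr0 : φ (pr x) = 0 := by
    have := map_lineMap φ (pr x) q (β x)
    rw [← hx'] at this
    have h5 : β x * φ q = φ x := div_mul_cancel₀ _ hq.ne'
    have h6 : (1 - β x) * φ (pr x) = 0 := by linarith
    rcases mul_eq_zero.1 h6 with h | h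
    · linarith
    · exact h
  have hS : Convex ℝ (convexHull ℝ ({c, q, u} : Set Plane)) := convex_convexHull _ _
  have hsub := subset_convexHull ℝ ({c, q, u} : Set Plane)
  have hprm : pr x ∈ convexHull ℝ ({c, q, u} : Set Plane) := by
    exact hS.segment_subset (hsub (by simp)) (hsub (by simp))
      (h1 (exists_lineMap_of_eq_zero hcu hc hu hq.ne' hpr0))
  rw [hx']
  exact hS.segment_subset hprm (hsub (by simp)) (lineMap_mem_segment _ _ hβ0 h3.le)

/-! ### Polygonal sets and rotating sight lines -/

/-- The properties of the closed region `P` of a simple polygon with vertex set `V` that the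
arguments on visibility use. -/
structure PolygonalSet (P V : Set Plane) : Prop where
  finite : V.Finite
  isClosed : IsClosed P
  /-- `P` is locally star-shaped at each of its points. -/
  star : ∀ p ∈ P, ∀ᶠ z in 𝓝 p, z ∈ P → segment ℝ z p ⊆ P
  /-- `P` has no holes. -/
  triangle : ∀ a b c, segment ℝ a b ⊆ P → segment ℝ a c ⊆ P → segment ℝ b c ⊆ P →
    convexHull ℝ {a, b, c} ⊆ P
  /-- Only vertices obstruct a sight line that is turned about its first endpoint. -/
  stable : ∀ a b, segment ℝ a b ⊆ P → (∀ x ∈ V, x ∈ segment ℝ a b → x = a) →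
    ∀ᶠ b' in 𝓝 b, b' ∈ P → segment ℝ a b' ⊆ P
  /-- A line that passes through a vertex inside `P` is obstructed there from one side at most,
  unless `P` is contained in the line near the vertex. -/
  oneSide : ∀ v ∈ V, ∀ (ψ : Plane →ᵃ[ℝ] ℝ) (x y w : Plane), v ∈ openSegment ℝ x y → x ≠ y →
    segment ℝ x y ⊆ P → ψ x = 0 → ψ y = 0 → segment ℝ v w ⊆ P → ψ w ≠ 0 →
    (∀ᶠ q in 𝓝 v, 0 < ψ q → q ∈ P) ∨ (∀ᶠ q in 𝓝 v, ψ q < 0 → q ∈ P)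

theorem isClosed_setOf_sees {P : Set Plane} (hP : IsClosed P) :
    IsClosed {w : Plane × Plane | segment ℝ w.1 w.2 ⊆ P} := by
  have : {w : Plane × Plane | segment ℝ w.1 w.2 ⊆ P} =
      ⋂ t ∈ Icc (0:ℝ) 1, {w : Plane × Plane | w.1 + t • (w.2 - w.1) ∈ P} := by
    ext w
    simp only [segment_eq_image', mem_ofPred_eq, image_subset_iff, mem_iInter]
    rfl
  rw [this]
  exact isClosed_biInter fun t _ => hP.preimage (by fun_prop)

theorem isClosed_setOf_sees_right {P : Set Plane} (hP : IsClosed P) (z : Plane) :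
    IsClosed {x : Plane | segment ℝ z x ⊆ P} :=
  (isClosed_setOf_sees hP).preimage (Continuous.prodMk_right z)

/-- The union of two consecutive collinear sight lines is a sight line. -/
theorem sees_of_mem {P : Set Plane} {a b x : Plane} (hx : x ∈ segment ℝ a b)
    (h1 : segment ℝ a x ⊆ P) (h2 : segment ℝ x b ⊆ P) : segment ℝ a b ⊆ P :=
  (segment_subset_union hx).trans (union_subset h1 h2)

namespace PolygonalSet

variable {P V : Set Plane} (hP : PolygonalSet P V)
include hP

theorem sees_of_triangle {a b c x : Plane} (hab : segment ℝ a b ⊆ P) (hac : segment ℝ a c ⊆ P)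
    (hbc : segment ℝ b c ⊆ P) (hx : x ∈ segment ℝ b c) : segment ℝ a x ⊆ P := by
  refine Subset.trans ?_ (hP.triangle a b c hab hac hbc)
  have hS : Convex ℝ (convexHull ℝ ({a, b, c} : Set Plane)) := convex_convexHull _ _
  have hsub := subset_convexHull ℝ ({a, b, c} : Set Plane)
  exact hS.segment_subset (hsub (by simp))
    (hS.segment_subset (hsub (by simp)) (hsub (by simp)) hx)

/-- A sight line from `z` can be turned along a segment in `P` as long as it meets no vertex. -/
theorem rotate {z g0 g1 : Plane} (h0 : segment ℝ z g0 ⊆ P) (hg : segment ℝ g0 g1 ⊆ P)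
    (hV : ∀ t : ℝ, 0 ≤ t → t < 1 → segment ℝ z (AffineMap.lineMap g0 g1 t) ⊆ P →
      ∀ x ∈ V, x ∈ segment ℝ z (AffineMap.lineMap g0 g1 t) → x = z) : segment ℝ z g1 ⊆ P := by
  let S : Set ℝ := {t | segment ℝ z (AffineMap.lineMap g0 g1 t : Plane) ⊆ P}
  have hc : Continuous fun t : ℝ => (AffineMap.lineMap g0 g1 t : Plane) :=
    AffineMap.lineMap_continuous
  have hS : IsClosed S := (isClosed_setOf_sees_right hP.isClosed z).preimage hc
  have key : Icc (0:ℝ) 1 ⊆ S := by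
    apply (hS.inter isClosed_Icc).Icc_subset_of_forall_exists_gt
    · simpa [S] using h0
    · rintro t ⟨htS, ht0, ht1⟩ y hy
      have h1 := hP.stable z _ htS (hV t ht0 ht1 htS)
      have h2 : ∀ᶠ s in 𝓝[>] t, (AffineMap.lineMap g0 g1 s : Plane) ∈ P → s ∈ S :=
        ((hc.tendsto t).mono_left nhdsWithin_le_nhds).eventually h1
      have h3 : ∀ᶠ s in 𝓝[>] t, s ∈ Ioc t (min y 1) :=
        Ioc_mem_nhdsGT (lt_min hy ht1)
      obtain ⟨s, hs2, hs3⟩ := (h2.and h3).exists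
      refine ⟨s, hs2 (hg (lineMap_mem_segment _ _ (ht0.trans hs3.1.le)
        (hs3.2.trans (min_le_right _ _)))), hs3.1, hs3.2.trans (min_le_left _ _)⟩
  have := key (right_mem_Icc.2 zero_le_one)
  simpa [S] using this

/-- Turning a sight line inside a convex set `T` whose vertices lie on the line `φ = 0`: on the
positive side of that line there are no obstructions. -/
theorem rotate_pos {φ : Plane →ᵃ[ℝ] ℝ} {T : Set Plane} (hT : Convex ℝ T)
    (hTV : ∀ x ∈ V, x ∈ T → φ x = 0) {z g0 g1 : Plane} (hz : z ∈ T) (hg0 : g0 ∈ T) (hg1 : g1 ∈ T)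
    (hφz : 0 ≤ φ z) (hφ0 : 0 < φ g0) (hφ1 : 0 ≤ φ g1) (h0 : segment ℝ z g0 ⊆ P)
    (hg : segment ℝ g0 g1 ⊆ P) : segment ℝ z g1 ⊆ P := by
  refine hP.rotate h0 hg fun t ht0 ht1 _ x hxV hx => ?_
  have hgT := hT.segment_subset hg0 hg1 (lineMap_mem_segment g0 g1 ht0 ht1.le)
  have hpos : 0 < φ (AffineMap.lineMap g0 g1 t) := by
    rw [map_lineMap]
    have : 0 < (1 - t) * φ g0 := mul_pos (by linarith) hφ0
    have : 0 ≤ t * φ g1 := mul_nonneg ht0 hφ1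
    linarith
  have hx0 := hTV x hxV (hT.segment_subset hz hgT hx)
  obtain ⟨s, hs0, hs1, rfl⟩ := mem_segment_iff_lineMap.1 hx
  rw [map_lineMap] at hx0
  have h1 : 0 ≤ (1 - s) * φ z := mul_nonneg (by linarith) hφz
  have h2 : s * φ (AffineMap.lineMap g0 g1 t) = 0 := by
    have := mul_nonneg hs0 hpos.le
    linarith
  rcases mul_eq_zero.1 h2 with h | h
  · simp [h]
  · exact absurd h hpos.ne'

end PolygonalSet

/-- Affine coordinates `(χ, φ)` adapted to a sight line from `p` to `u`: the line `p u` is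
`φ = 0`, with `p` at `χ = 1` and `u` at `χ = 0`. -/
structure IsFrame (φ χ : Plane →ᵃ[ℝ] ℝ) (p u : Plane) : Prop where
  φp : φ p = 0
  φu : φ u = 0
  χp : χ p = 1
  χu : χ u = 0
  inj : ∀ x y, φ x = φ y → χ x = χ y → x = y

namespace IsFrame

variable {φ χ : Plane →ᵃ[ℝ] ℝ} {p u : Plane}

theorem neg (h : IsFrame φ χ p u) : IsFrame (-φ) χ p u where
  φp := by simp [h.φp]
  φu := by simp [h.φu]
  χp := h.χp
  χu := h.χu
  inj x y h1 h2 := h.inj x y (by simpa using h1) h2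

theorem eq_lineMap (h : IsFrame φ χ p u) {x : Plane} (hx : φ x = 0) :
    x = AffineMap.lineMap u p (χ x) := by
  apply h.inj
  · rw [map_lineMap, h.φp, h.φu, hx]; ring
  · rw [map_lineMap, h.χp, h.χu]; ring

theorem mem_segment_iff (h : IsFrame φ χ p u) {x : Plane} :
    x ∈ segment ℝ p u ↔ φ x = 0 ∧ 0 ≤ χ x ∧ χ x ≤ 1 := by
  constructor
  · intro hx
    obtain ⟨t, h0, h1, rfl⟩ := mem_segment_iff_lineMap.1 hx
    simp only [map_lineMap, h.φp, h.φu, h.χp, h.χu]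
    refine ⟨by ring, by linarith, by linarith⟩
  · rintro ⟨hx, h0, h1⟩
    rw [segment_symm, h.eq_lineMap hx]
    exact lineMap_mem_segment _ _ h0 h1

theorem mem_segment_of_le (h : IsFrame φ χ p u) {x c : Plane} (hx : φ x = 0) (hc : φ c = 0)
    (h0 : 0 ≤ χ x) (hxc : χ x ≤ χ c) : x ∈ segment ℝ c u := by
  rcases eq_or_lt_of_le (h0.trans hxc) with hc0 | hc0
  · have : x = u := h.inj _ _ (hx.trans h.φu.symm) (by rw [h.χu]; linarith)
    rw [this]; exact right_mem_segment _ _ _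
  · rw [segment_symm]
    refine mem_segment_iff_lineMap.2 ⟨χ x / χ c, by positivity, (div_le_one hc0).2 hxc, ?_⟩
    apply h.inj
    · rw [map_lineMap, hx, hc, h.φu]; ring
    · rw [map_lineMap, h.χu]; field_simp; ring

/-- A point on the line `p u` on the same side of `u` as `p` sees `u` if it sees `p`. -/
theorem sees_of_eq_zero (h : IsFrame φ χ p u) {P : Set Plane} {z : Plane} (hz : φ z = 0)
    (hχ : 0 ≤ χ z) (hzp : segment ℝ z p ⊆ P) (hpu : segment ℝ p u ⊆ P) : segment ℝ z u ⊆ P := by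
  rcases le_total (χ z) 1 with h1 | h1
  · exact (segment_subset_segment (h.mem_segment_iff.2 ⟨hz, hχ, h1⟩)
      (right_mem_segment _ _ _)).trans hpu
  · refine sees_of_mem (h.mem_segment_of_le h.φp hz ?_ ?_) hzp hpu
    · rw [h.χp]; norm_num
    · rwa [h.χp]

end IsFrame

/-- The part of the segment `p u` visible from a point `z` off the line `p u` ends in a vertex. -/
theorem PolygonalSet.exists_last_visible {P V : Set Plane} (hP : PolygonalSet P V)
    {φ χ : Plane →ᵃ[ℝ] ℝ} {p u : Plane} (hf : IsFrame φ χ p u) {T : Set Plane}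
    (hT : Convex ℝ T) (hTV : ∀ x ∈ V, x ∈ T → φ x = 0) (hpT : p ∈ T) (huT : u ∈ T) {z : Plane}
    (hzT : z ∈ T) (hφz : φ z ≠ 0) (hzp : segment ℝ z p ⊆ P) (hpu : segment ℝ p u ⊆ P)
    (hzu : ¬ segment ℝ z u ⊆ P) :
    ∃ v ∈ V, v ∈ segment ℝ p u ∧ segment ℝ z v ⊆ P ∧ 0 < χ v ∧
      ∀ x ∈ segment ℝ p u, segment ℝ z x ⊆ P → χ v ≤ χ x := by
  let S : Set Plane := segment ℝ p u ∩ {x | segment ℝ z x ⊆ P}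
  have hScomp : IsCompact S := by
    apply IsCompact.inter_right _ (isClosed_setOf_sees_right hP.isClosed z)
    rw [segment_eq_image_lineMap]
    exact isCompact_Icc.image AffineMap.lineMap_continuous
  obtain ⟨v, ⟨hvs, hzv⟩, hmin⟩ := hScomp.exists_isMinOn ⟨p, left_mem_segment _ _ _, hzp⟩
    (continuous_functional χ).continuousOn
  obtain ⟨hφv, hχ0, hχ1⟩ := hf.mem_segment_iff.1 hvs
  have hpos : 0 < χ v := by
    rcases eq_or_lt_of_le hχ0 with h | h
    · have : v = u := hf.inj _ _ (hφv.trans hf.φu.symm) (by rw [hf.χu, ← h])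
      exact absurd (this ▸ hzv) hzu
    · exact h
  have hmin' : ∀ x ∈ segment ℝ p u, segment ℝ z x ⊆ P → χ v ≤ χ x :=
    fun x hx hzx => hmin ⟨hx, hzx⟩
  refine ⟨v, ?_, hvs, hzv, hpos, hmin'⟩
  by_contra hvV
  have hvT : v ∈ T := hT.segment_subset hpT huT hvs
  have hst := hP.stable z v hzv (fun x hxV hx => by
    have hx0 := hTV x hxV (hT.segment_subset hzT hvT hx)
    obtain ⟨s, hs0, hs1, rfl⟩ := mem_segment_iff_lineMap.1 hx
    rw [map_lineMap, hφv, mul_zero, add_zero] at hx0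
    rcases mul_eq_zero.1 hx0 with h | h
    · have : s = 1 := by linarith
      subst this
      simp only [AffineMap.lineMap_apply_one] at hxV
      exact absurd hxV hvV
    · exact absurd h hφz)
  obtain ⟨t, hat, ⟨ht0, ht1⟩⟩ :=
    ((eventually_lineMap_mem (b := u) hst).and eventually_pos_lt_one).exists
  have hmem : AffineMap.lineMap v u t ∈ segment ℝ p u :=
    segment_subset_segment hvs (right_mem_segment _ _ _) (lineMap_mem_segment _ _ ht0.le ht1.le)
  have := hmin' _ hmem (hat (hpu hmem))
  rw [map_lineMap, hf.χu] at this
  nlinarith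

/-! ### Seeing an edge past the last visible vertex -/

theorem exists_zero_mem_segment {φ : Plane →ᵃ[ℝ] ℝ} {x y : Plane} (h : φ x * φ y < 0) :
    ∃ t : ℝ, 0 < t ∧ t < 1 ∧ φ (AffineMap.lineMap x y t) = 0 := by
  have hne : φ x - φ y ≠ 0 := by
    intro h0
    have : φ x = φ y := by linarith
    rw [this] at h; nlinarith [sq_nonneg (φ y)]
  refine ⟨φ x / (φ x - φ y), ?_, ?_, ?_⟩
  · have : φ x / (φ x - φ y) = φ x * (φ x - φ y) / (φ x - φ y) ^ 2 := by field_simp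
    rw [this]
    have : 0 < φ x * (φ x - φ y) := by nlinarith [sq_nonneg (φ x)]
    positivity
  · have : 1 - φ x / (φ x - φ y) = - φ y * (φ x - φ y) / (φ x - φ y) ^ 2 := by field_simp; ring
    have h2 : 0 < - φ y * (φ x - φ y) := by nlinarith [sq_nonneg (φ y)]
    have h3 : 0 < - φ y * (φ x - φ y) / (φ x - φ y) ^ 2 := by positivity
    linarith
  · rw [map_lineMap]; field_simp; ring

/-- If a segment `a b` in the line `χ = 0` passes through `u` and reaches the negative side of
`φ`, then it does so at one of its endpoints. -/
theorem exists_neg_endpoint {φ : Plane →ᵃ[ℝ] ℝ} {u a b u' : Plane} (hφu : φ u = 0)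
    (hu : u ∈ segment ℝ a b) (hu' : u' ∈ segment ℝ a b) (h : φ u' < 0) :
    ∃ b', (b' = a ∨ b' = b) ∧ φ b' < 0 ∧ u' ∈ segment ℝ u b' := by
  have key : ∀ b', u' ∈ segment ℝ u b' → φ b' < 0 := by
    intro b' hb'
    obtain ⟨t, h0, h1, rfl⟩ := mem_segment_iff_lineMap.1 hb'
    rw [map_lineMap, hφu] at h
    nlinarith
  rcases segment_subset_union hu hu' with h1 | h1
  · rw [segment_symm] at h1
    exact ⟨a, Or.inl rfl, key _ h1, h1⟩
  · exact ⟨b, Or.inr rfl, key _ h1, h1⟩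

/-- If the vertex `v` is unobstructed on the side `ψ > 0` of a line through it, then a point `z`
seeing `v` on this closed side sees a little of every sight line `v w` on this closed side. -/
theorem PolygonalSet.exists_sees_beyond {P V : Set Plane} (hP : PolygonalSet P V)
    {φ ψ : Plane →ᵃ[ℝ] ℝ} {T : Set Plane} (hT : Convex ℝ T) (hTV : ∀ x ∈ V, x ∈ T → φ x = 0)
    {z v w : Plane} (hzT : z ∈ T) (hvT : v ∈ T) (hwT : w ∈ T) (hφv : φ v = 0) (hφz : 0 < φ z)
    (hφw : 0 ≤ φ w) (hzv : segment ℝ z v ⊆ P) (hvw : segment ℝ v w ⊆ P) (hψv : ψ v = 0)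
    (hψz : 0 ≤ ψ z) (hψw : 0 ≤ ψ w) (hpos : 0 < ψ z ∨ 0 < ψ w)
    (hfree : ∀ᶠ q in 𝓝 v, 0 < ψ q → q ∈ P) :
    ∃ s : ℝ, 0 < s ∧ s < 1 ∧ segment ℝ z (AffineMap.lineMap v w s) ⊆ P := by
  obtain ⟨ρ, hρ, hball⟩ := Metric.eventually_nhds_iff_ball.1 hfree
  obtain ⟨s, ⟨hs1, hs2⟩, hs0, hs3⟩ := (((eventually_lineMap_mem (b := z)
    (Metric.ball_mem_nhds v hρ)).and (eventually_lineMap_mem (b := w)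
    (Metric.ball_mem_nhds v hρ))).and eventually_pos_lt_one).exists
  refine ⟨s, hs0, hs3, ?_⟩
  set m : Plane := AffineMap.lineMap v z s with hm
  set g : Plane := AffineMap.lineMap v w s with hg
  have hmz : m ∈ segment ℝ z v := by
    rw [segment_symm]; exact lineMap_mem_segment _ _ hs0.le hs3.le
  have hgw : g ∈ segment ℝ v w := lineMap_mem_segment _ _ hs0.le hs3.le
  have hφm : φ m = s * φ z := by rw [hm, map_lineMap, hφv]; ring
  have hφg : φ g = s * φ w := by rw [hg, map_lineMap, hφv]; ring
  have hψm : ψ m = s * ψ z := by rw [hm, map_lineMap, hψv]; ring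
  have hψg : ψ g = s * ψ w := by rw [hg, map_lineMap, hψv]; ring
  have hzm : segment ℝ z m ⊆ P :=
    (segment_subset_segment (left_mem_segment _ _ _) hmz).trans hzv
  refine hP.rotate_pos hT hTV hzT (hT.segment_subset hzT hvT hmz) (hT.segment_subset hvT hwT hgw)
    hφz.le (by rw [hφm]; positivity) (by rw [hφg]; positivity) hzm ?_
  intro x hx
  have hxb := (convex_ball v ρ).segment_subset hs1 hs2 hx
  obtain ⟨r, hr0, hr1, rfl⟩ := mem_segment_iff_lineMap.1 hx
  rcases eq_or_lt_of_le hr0 with h0 | h0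
  · rw [← h0, AffineMap.lineMap_apply_zero]; exact hzv hmz
  rcases eq_or_lt_of_le hr1 with h1 | h1
  · rw [h1, AffineMap.lineMap_apply_one]; exact hvw hgw
  refine hball _ hxb ?_
  rw [map_lineMap, hψm, hψg]
  have h2 : 0 < 1 - r := by linarith
  rcases hpos with h | h <;> positivity

/-- The case of `sees_of_frame` in which the sight line from `z'` to `u'` passes exactly through
the vertex `v` at which the view of `z` along `p u` ends: such a vertex is obstructed from one side
at most, so either `z` sees `u`, or `z'` sees points beyond `v`. -/
theorem PolygonalSet.sees_or_sees_beyond {P V : Set Plane} (hP : PolygonalSet P V)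
    {φ χ : Plane →ᵃ[ℝ] ℝ} {u v z z' u' : Plane} {T : Set Plane} (hT : Convex ℝ T)
    (hTV : ∀ x ∈ V, x ∈ T → φ x = 0) (huT : u ∈ T) (hvT : v ∈ T) (hzT : z ∈ T) (hzT' : z' ∈ T)
    (huT' : u' ∈ T) (hvV : v ∈ V) (hφu : φ u = 0) (hφv : φ v = 0) (hχu : χ u = 0) (hχu' : χ u' = 0)
    (hχv : 0 < χ v) (hχz : χ v < χ z) (hφz : 0 < φ z) (hφz' : φ z' < 0) (hφu' : 0 < φ u')
    (hv : v ∈ openSegment ℝ z' u') (hzv : segment ℝ z v ⊆ P) (hzu' : segment ℝ z' u' ⊆ P)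
    (hvu : segment ℝ v u ⊆ P) (hu'u : segment ℝ u' u ⊆ P) :
    segment ℝ z u ⊆ P ∨
      ∃ s : ℝ, 0 < s ∧ s < 1 ∧ segment ℝ z' (AffineMap.lineMap v u s) ⊆ P := by
  have hvs : v ∈ segment ℝ z' u' := openSegment_subset_segment _ _ _ hv
  have hvu' : segment ℝ v u' ⊆ P :=
    (segment_subset_segment hvs (right_mem_segment _ _ _)).trans hzu'
  have hzv' : segment ℝ z' v ⊆ P :=
    (segment_subset_segment (left_mem_segment _ _ _) hvs).trans hzu'
  -- the functional vanishing on the line `z' u'`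
  let ψ : Plane →ᵃ[ℝ] ℝ := χ v • φ + φ u' • (χ - AffineMap.const ℝ Plane (χ v))
  have hψ : ∀ x, ψ x = χ v * φ x + φ u' * (χ x - χ v) := fun x => by simp [ψ]
  have hψv : ψ v = 0 := by rw [hψ, hφv]; ring
  have hψu' : ψ u' = 0 := by rw [hψ, hχu']; ring
  have hψz' : ψ z' = 0 := by
    rw [openSegment_eq_image_lineMap] at hv
    obtain ⟨t, ⟨-, ht1⟩, ht⟩ := hv
    rw [← ht, map_lineMap, hψu'] at hψv
    have h2 : (1 - t) * ψ z' = 0 := by linarith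
    rcases mul_eq_zero.1 h2 with h | h
    · linarith
    · exact h
  have hψu : ψ u < 0 := by
    rw [hψ, hφu, hχu]; nlinarith
  have hψz : 0 < ψ z := by
    rw [hψ]
    have h2 := mul_pos hχv hφz
    have h3 := mul_pos hφu' (sub_pos.2 hχz)
    linarith
  have hne : z' ≠ u' := by rintro h; rw [h] at hφz'; linarith
  rcases hP.oneSide v hvV ψ z' u' u hv hne hzu' hψz' hψu' hvu hψu.ne with hfree | hfree
  · left
    obtain ⟨s, hs0, hs1, hzg⟩ := hP.exists_sees_beyond hT hTV hzT hvT huT' hφv hφz hφu'.le hzv hvu'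
      hψv hψz.le hψu'.ge (Or.inl hψz) hfree
    have hg := lineMap_mem_segment v u' hs0.le hs1.le
    have hgu : segment ℝ (AffineMap.lineMap v u' s) u ⊆ P := by
      rw [segment_symm]
      exact hP.sees_of_triangle (by rwa [segment_symm]) (by rwa [segment_symm]) hvu' hg
    refine hP.rotate_pos hT hTV hzT (hT.segment_subset hvT huT' hg) huT hφz.le ?_ hφu.ge hzg hgu
    rw [map_lineMap, hφv]; nlinarith
  · right
    refine hP.exists_sees_beyond (φ := -φ) (ψ := -ψ) hT (fun x hx hxT => by simp [hTV x hx hxT])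
      hzT' hvT huT ?_ ?_ ?_ hzv' hvu ?_ ?_ ?_ (Or.inr ?_) ?_
    · simp [hφv]
    · simpa using hφz'
    · simp [hφu]
    · simp [hψv]
    · simp [hψz']
    · simpa using hψu.le
    · simpa using hψu
    · simpa using hfree

/-- The heart of the matter. The point `z` is close to `p` and strictly on the positive side of
the line `p u`, where `u` is a point of the segment `a b` visible from `p`; another point `z'` close
to `p` sees a point `u'` of `a b` close to `u` and does not see more vertices than `z`. Then `z` sees
a point of `a b`. -/
theorem PolygonalSet.sees_of_frame {P V : Set Plane} (hP : PolygonalSet P V)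
    {φ χ : Plane →ᵃ[ℝ] ℝ} {p u a b : Plane} (hf : IsFrame φ χ p u) (ha : a ∈ V) (hb : b ∈ V)
    (hχa : χ a = 0) (hχb : χ b = 0) (hu : u ∈ segment ℝ a b) (hab : segment ℝ a b ⊆ P)
    (hpu : segment ℝ p u ⊆ P)
    {T : Set Plane} (hT : Convex ℝ T) (hTo : IsOpen T) (hTV : ∀ x ∈ V, x ∈ T → φ x = 0)
    (hpT : p ∈ T) (huT : u ∈ T) {z z' u' : Plane} (hzT : z ∈ T) (hzT' : z' ∈ T) (huT' : u' ∈ T)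
    (hzp : segment ℝ z p ⊆ P) (hzp' : segment ℝ z' p ⊆ P) (hφz : 0 < φ z) (hχz' : 0 < χ z')
    (hχz : ∀ v ∈ V, φ v = 0 → χ v < 1 → χ v < χ z)
    (hback : ∀ c ∈ P, φ c = 0 → 1 ≤ χ c → χ c ≤ χ z' → segment ℝ c p ⊆ P)
    (hy : ∀ v ∈ V, φ v = 0 → 0 < χ v → χ v < 1 → ∀ b', (b' = a ∨ b' = b) → φ b' < 0 →
      ∃ y ∈ segment ℝ u b', y ∈ T ∧ φ y < 0 ∧ v ∈ segment ℝ z y)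
    (hu' : u' ∈ segment ℝ a b) (hzu' : segment ℝ z' u' ⊆ P)
    (hM : ∀ x ∈ V, segment ℝ z' x ⊆ P → segment ℝ z x ⊆ P)
    (hw : p ∉ V ∨ ∃ w ∈ V, w ∈ segment ℝ p u ∧ w ≠ p ∧ segment ℝ z w ⊆ P) :
    ∃ y ∈ segment ℝ a b, segment ℝ z y ⊆ P := by
  by_contra hno
  push Not at hno
  have hzu : ¬ segment ℝ z u ⊆ P := hno u hu
  have hpuT : segment ℝ p u ⊆ T := hT.segment_subset hpT huT
  have hχe : ∀ g ∈ segment ℝ a b, χ g = 0 := by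
    intro g hg
    obtain ⟨t, -, -, rfl⟩ := mem_segment_iff_lineMap.1 hg
    rw [map_lineMap, hχa, hχb]; ring
  obtain ⟨v, hvV, hvs, hzv, hχv, hmin⟩ :=
    hP.exists_last_visible hf hT hTV hpT huT hzT hφz.ne' hzp hpu hzu
  obtain ⟨hφv, -, hχv1⟩ := hf.mem_segment_iff.1 hvs
  have hvT := hpuT hvs
  have hvuP : segment ℝ v u ⊆ P :=
    (segment_subset_segment hvs (right_mem_segment _ _ _)).trans hpu
  have hvp : v ≠ p := by
    rintro rfl
    rcases hw with h | ⟨w, hwV, hws, hwp, hzw⟩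
    · exact h hvV
    · have h1 := hmin w hws hzw
      obtain ⟨h2, -, h3⟩ := hf.mem_segment_iff.1 hws
      rw [hf.χp] at h1
      exact hwp (hf.inj _ _ (h2.trans hf.φp.symm) (by rw [hf.χp]; linarith))
  have hχv1' : χ v < 1 := by
    refine lt_of_le_of_ne hχv1 fun h => hvp (hf.inj _ _ (hφv.trans hf.φp.symm) ?_)
    rw [hf.χp, h]
  -- the sight line from `z` to `v` can be continued to the edge if `v` sees points beyond it
  have hfin : ∀ b', (b' = a ∨ b' = b) → φ b' < 0 → ∀ g ∈ segment ℝ u b', g ∈ T → φ g < 0 →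
      segment ℝ v g ⊆ P → False := by
    intro b' hb' hφb' g hg hgT hφg hvg
    obtain ⟨y, hyu, hyT, hφy, hvy⟩ := hy v hvV hφv hχv hχv1' b' hb' hφb'
    have hub' : segment ℝ u b' ⊆ segment ℝ a b := by
      refine segment_subset_segment hu ?_
      rcases hb' with rfl | rfl
      · exact left_mem_segment _ _ _
      · exact right_mem_segment _ _ _
    have h1 : segment ℝ v y ⊆ P := by
      refine hP.rotate_pos (φ := -φ) hT (fun x hx hxT => by simp [hTV x hx hxT]) hvT hgT hyT
        ?_ ?_ ?_ hvg ((segment_subset_segment hg hyu).trans (hub'.trans hab))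
      · simp [hφv]
      · simpa using hφg
      · simpa using hφy.le
    exact hno y (hub' hyu) (sees_of_mem hvy hzv h1)
  by_cases hzu2 : segment ℝ z' u ⊆ P
  · -- `z'` sees all of `p u`, so `v` is the last vertex on it
    have hlast : ∀ x ∈ V, x ∈ segment ℝ v u → x = v := by
      intro x hxV hx
      have hxs := segment_subset_segment hvs (right_mem_segment _ _ _) hx
      have h1 := hmin x hxs (hM x hxV (hP.sees_of_triangle hzp' hzu2 hpu hxs))
      obtain ⟨t, h0, ht1, rfl⟩ := mem_segment_iff_lineMap.1 hx
      have h2 := (hf.mem_segment_iff.1 hxs).1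
      rw [map_lineMap, hf.χu] at h1
      have : t = 0 := by nlinarith
      simp [this]
    have huV : u ∉ V := fun h => hzu (hM u h hzu2)
    have hends : ∃ b', (b' = a ∨ b' = b) ∧ φ b' < 0 := by
      have hφa : φ a ≠ 0 := fun h => huV
        (hf.inj u a (hf.φu.trans h.symm) (hf.χu.trans hχa.symm) ▸ ha)
      have hφb : φ b ≠ 0 := fun h => huV
        (hf.inj u b (hf.φu.trans h.symm) (hf.χu.trans hχb.symm) ▸ hb)
      by_contra hcon
      push Not at hcon
      have h1 := lt_of_le_of_ne (hcon a (Or.inl rfl)) hφa.symm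
      have h2 := lt_of_le_of_ne (hcon b (Or.inr rfl)) hφb.symm
      obtain ⟨t, h0, ht1, htu⟩ := mem_segment_iff_lineMap.1 hu
      have h3 := hf.φu
      rw [htu, map_lineMap] at h3
      rcases eq_or_lt_of_le h0 with h | h
      · rw [← h] at h3; linarith
      · nlinarith
    obtain ⟨b', hb', hφb'⟩ := hends
    have hub' : segment ℝ u b' ⊆ segment ℝ a b := by
      refine segment_subset_segment hu ?_
      rcases hb' with rfl | rfl
      · exact left_mem_segment _ _ _
      · exact right_mem_segment _ _ _
    have hst := hP.stable v u hvuP hlast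
    obtain ⟨t, ⟨hst', htT⟩, ht0, ht1⟩ := (((eventually_lineMap_mem (b := b') hst).and
      (eventually_lineMap_mem (b := b') (hTo.mem_nhds huT))).and eventually_pos_lt_one).exists
    have hg := lineMap_mem_segment u b' ht0.le ht1.le
    refine hfin b' hb' hφb' _ hg htT ?_ (hst' (hab (hub' hg)))
    rw [map_lineMap, hf.φu]
    nlinarith
  · have hφz' : φ z' ≠ 0 := fun h => hzu2 (hf.sees_of_eq_zero h hχz'.le hzp' hpu)
    obtain ⟨v', hvV', hvs', hzv', hχv', hmin'⟩ :=
      hP.exists_last_visible hf hT hTV hpT huT hzT' hφz' hzp' hpu hzu2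
    have hvv' : χ v ≤ χ v' := hmin v' hvs' (hM v' hvV' hzv')
    have hu'u : segment ℝ u' u ⊆ P := (segment_subset_segment hu' hu).trans hab
    have hφu' : φ u' ≠ 0 := fun h => hzu2
      (hf.inj u' u (h.trans hf.φu.symm) ((hχe u' hu').trans hf.χu.symm) ▸ hzu')
    -- `u'` lies on the other side of the line `p u` than `z'`
    have hopp : φ z' * φ u' < 0 := by
      by_contra hcon
      push Not at hcon
      apply hzu2
      rcases lt_or_gt_of_ne hφz' with h | h
      · have h2 : φ u' < 0 := lt_of_le_of_ne (by nlinarith) hφu'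
        refine hP.rotate_pos (φ := -φ) hT (fun x hx hxT => by simp [hTV x hx hxT]) hzT' huT' huT
          ?_ ?_ ?_ hzu' hu'u
        · simpa using h.le
        · simpa using h2
        · simp [hf.φu]
      · have h2 : 0 < φ u' := lt_of_le_of_ne (by nlinarith) hφu'.symm
        exact hP.rotate_pos hT hTV hzT' huT' huT h.le h2 hf.φu.ge hzu' hu'u
    obtain ⟨t, ht0, ht1, hφc⟩ := exists_zero_mem_segment hopp
    set c : Plane := AffineMap.lineMap z' u' t with hc
    have hcs : c ∈ segment ℝ z' u' := lineMap_mem_segment _ _ ht0.le ht1.le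
    have hcP : c ∈ P := hzu' hcs
    have hχc : χ c = (1 - t) * χ z' := by rw [hc, map_lineMap, hχe u' hu']; ring
    have hχc0 : 0 < χ c := by rw [hχc]; exact mul_pos (by linarith) hχz'
    have hχcz : χ c ≤ χ z' := by rw [hχc]; nlinarith
    have hzc : segment ℝ z' c ⊆ P :=
      (segment_subset_segment (left_mem_segment _ _ _) hcs).trans hzu'
    have hcu' : segment ℝ c u' ⊆ P :=
      (segment_subset_segment hcs (right_mem_segment _ _ _)).trans hzu'
    have hv'c : χ v' ≤ χ c := by
      rcases le_total (χ c) 1 with h | h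
      · exact hmin' c (hf.mem_segment_iff.2 ⟨hφc, hχc0.le, h⟩) hzc
      · exact ((hf.mem_segment_iff.1 hvs').2.2).trans h
    have hvc : χ v ≤ χ c := hvv'.trans hv'c
    have hcu : segment ℝ c u ⊆ P := by
      rcases le_total (χ c) 1 with h | h
      · exact (segment_subset_segment (hf.mem_segment_iff.2 ⟨hφc, hχc0.le, h⟩)
          (right_mem_segment _ _ _)).trans hpu
      · exact hf.sees_of_eq_zero hφc hχc0.le (hback c hcP hφc h hχcz) hpu
    have hvcu : v ∈ segment ℝ c u := hf.mem_segment_of_le hφv hφc hχv.le hvc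
    have hu'v : segment ℝ u' v ⊆ P :=
      hP.sees_of_triangle (by rwa [segment_symm]) hu'u hcu hvcu
    rcases lt_or_gt_of_ne hφz' with hz'neg | hz'pos
    · have hu'pos : 0 < φ u' := by nlinarith
      have htri : convexHull ℝ {c, u', u} ⊆ P := hP.triangle _ _ _ hcu' hcu hu'u
      have hS : Convex ℝ (convexHull ℝ ({c, u', u} : Set Plane)) := convex_convexHull _ _
      have hsub := subset_convexHull ℝ ({c, u', u} : Set Plane)
      have hcune : c ≠ u := by
        rintro h; rw [h, hf.χu] at hχc0; exact lt_irrefl _ hχc0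
      rcases eq_or_lt_of_le hvc with hEq | hlt
      · -- the sight line of `z'` passes through the vertex `v`
        have hcv : c = v := hf.inj _ _ (hφc.trans hφv.symm) hEq.symm
        have hv'v : v' = v := hf.inj _ _
          (((hf.mem_segment_iff.1 hvs').1).trans hφv.symm) (le_antisymm (hEq ▸ hv'c) hvv')
        have hvo : v ∈ openSegment ℝ z' u' := by
          rw [openSegment_eq_image_lineMap]
          exact ⟨t, ⟨ht0, ht1⟩, by rw [← hcv]⟩
        rcases hP.sees_or_sees_beyond hT hTV huT hvT hzT hzT' huT' hvV hf.φu hφv hf.χu (hχe u' hu')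
          hχv (hχz v hvV hφv hχv1') hφz hz'neg hu'pos hvo hzv hzu' hvuP hu'u with h | ⟨s, hs0, hs1, h⟩
        · exact hzu h
        · have h1 := hmin' _ (segment_subset_segment hvs (right_mem_segment _ _ _)
            (lineMap_mem_segment v u hs0.le hs1.le)) h
          rw [hv'v, map_lineMap, hf.χu] at h1
          nlinarith
      · -- the triangle `c u' u` contains points of the sight line from `z` to `v`
        have hvo : v ∈ openSegment ℝ c u := by
          rw [openSegment_symm, openSegment_eq_image_lineMap]
          refine ⟨χ v / χ c, ⟨by positivity, (div_lt_one hχc0).2 hlt⟩, ?_⟩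
          apply hf.inj
          · rw [map_lineMap, hφv, hφc, hf.φu]; ring
          · rw [map_lineMap, hf.χu]; field_simp; ring
        have hev := eventually_mem_triangle hφc hf.φu hu'pos hcune hvo
        obtain ⟨s, hs1, hs0, hs3⟩ := ((eventually_lineMap_mem (b := z) hev).and
          eventually_pos_lt_one).exists
        set m : Plane := AffineMap.lineMap v z s
        have hmz : m ∈ segment ℝ z v := by
          rw [segment_symm]; exact lineMap_mem_segment _ _ hs0.le hs3.le
        have hφm : 0 < φ m := by rw [map_lineMap, hφv]; nlinarith
        have hmT : m ∈ T := hT.segment_subset hzT hvT hmz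
        have hzm : segment ℝ z m ⊆ P :=
          (segment_subset_segment (left_mem_segment _ _ _) hmz).trans hzv
        exact hzu (hP.rotate_pos hT hTV hzT hmT huT hφz.le hφm hf.φu.ge hzm
          ((hS.segment_subset (hs1 hφm.le) (hsub (by simp))).trans htri))
    · have hu'neg : φ u' < 0 := by nlinarith
      obtain ⟨b', hb', hφb', hub'⟩ := exists_neg_endpoint hf.φu hu hu' hu'neg
      exact hfin b' hb' hφb' u' hub' huT' hu'neg (by rwa [segment_symm])

/-! ### Local monotonicity of weak visibility -/

theorem eventually_map_lt {φ : Plane →ᵃ[ℝ] ℝ} {p : Plane} {r : ℝ} (h : φ p < r) :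
    ∀ᶠ z in 𝓝 p, φ z < r :=
  (continuous_functional φ).continuousAt.eventually (gt_mem_nhds h)

theorem eventually_lt_map {φ : Plane →ᵃ[ℝ] ℝ} {p : Plane} {r : ℝ} (h : r < φ p) :
    ∀ᶠ z in 𝓝 p, r < φ z :=
  (continuous_functional φ).continuousAt.eventually (lt_mem_nhds h)

/-- The sight line through `p` and `u` and a transversal segment `a b` through `u` give a frame. -/
theorem exists_isFrame {p u a b : Plane} (hu : u ∈ segment ℝ a b)
    (hp : sideMap a (b - a) p ≠ 0) :
    ∃ φ χ : Plane →ᵃ[ℝ] ℝ, IsFrame φ χ p u ∧ χ a = 0 ∧ χ b = 0 := by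
  set χ₀ := sideMap a (b - a) with hχ₀
  have h0a : χ₀ a = 0 := sideMap_self _ _
  have h0b : χ₀ b = 0 := sideMap_sub_self _ _
  have h0u : χ₀ u = 0 := by
    obtain ⟨t, -, -, rfl⟩ := mem_segment_iff_lineMap.1 hu
    rw [map_lineMap, h0a, h0b]; ring
  have hpu : p - u ≠ 0 := by
    intro h; rw [sub_eq_zero.1 h] at hp; exact hp h0u
  refine ⟨sideMap u (p - u), (χ₀ p)⁻¹ • χ₀, ⟨sideMap_sub_self _ _, sideMap_self _ _, ?_, ?_, ?_⟩,
    ?_, ?_⟩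
  · simp [hp]
  · simp [h0u]
  · intro x y h1 h2
    have h3 : χ₀ x = χ₀ y := by simpa [hp] using h2
    have h4 : sideMap u (p - u) (u + (x - y)) = 0 := by
      rw [sideMap_apply, sideMap_apply] at h1
      rw [sideMap_apply]
      simp only [PiLp.add_apply, PiLp.sub_apply] at *
      linear_combination h1
    obtain ⟨t, ht⟩ := eq_add_smul_of_sideMap_eq_zero hpu h4
    have hxy : x - y = t • (p - u) := add_left_cancel ht
    have hx : x = t • (p - u) + y := by rw [← hxy]; abel
    have h5 : t * χ₀ p = 0 := by
      rw [hχ₀, sideMap_apply] at h0u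
      rw [hχ₀, hx, sideMap_apply, sideMap_apply] at h3
      rw [hχ₀, sideMap_apply]
      simp only [PiLp.add_apply, PiLp.smul_apply, PiLp.sub_apply, smul_eq_mul] at *
      linear_combination h3 + t * h0u
    have h6 : t = 0 := (mul_eq_zero.1 h5).resolve_right hp
    rw [hx, h6]; simp
  · simp [h0a]
  · simp [h0b]

/-- A line through a vertex `v` between `p` and `u` and a point close to `p` meets the edge in a
point close to `u`. -/
theorem IsFrame.eventually_exists_ray {φ χ : Plane →ᵃ[ℝ] ℝ} {p u : Plane} (hf : IsFrame φ χ p u)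
    {T : Set Plane} (hTo : IsOpen T) (huT : u ∈ T) {v b : Plane} (hφv : φ v = 0) (hχv : 0 < χ v)
    (hχv1 : χ v < 1) (hχb : χ b = 0) (hφb : φ b < 0) :
    ∀ᶠ z in 𝓝 p, 0 < φ z →
      ∃ y ∈ segment ℝ u b, y ∈ T ∧ φ y < 0 ∧ v ∈ segment ℝ z y := by
  let r : Plane → ℝ := fun z => χ z / (χ z - χ v)
  let Y : Plane → Plane := fun z => AffineMap.lineMap z v (r z)
  have hcφ := continuous_functional φ
  have hcχ := continuous_functional χ
  have hrc : ContinuousAt r p :=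
    hcχ.continuousAt.div (hcχ.continuousAt.sub continuousAt_const)
      (by simp only [hf.χp]; linarith)
  have hYc : ContinuousAt Y p := by
    have h1 : Y = fun z => r z • (v - z) + z := by
      funext z; exact AffineMap.lineMap_apply_module' _ _ _
    rw [h1]
    exact (hrc.smul (continuousAt_const.sub continuousAt_id)).add continuousAt_id
  have hYχ : ∀ z, χ v < χ z → χ (Y z) = 0 := by
    intro z hz
    have : χ z - χ v ≠ 0 := by linarith
    simp only [Y, r, map_lineMap]
    field_simp
    ring
  have hYp : Y p = u := by
    apply hf.inj
    · simp only [Y, map_lineMap, hf.φp, hφv, hf.φu]; ring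
    · rw [hYχ p (by rw [hf.χp]; exact hχv1), hf.χu]
  have ev1 : ∀ᶠ z in 𝓝 p, Y z ∈ T := hYc.eventually (hTo.mem_nhds (by rwa [hYp]))
  have ev2 : ∀ᶠ z in 𝓝 p, φ b < φ (Y z) :=
    (hcφ.continuousAt.comp hYc).eventually
      (lt_mem_nhds (by simpa only [Function.comp, hYp, hf.φu] using hφb))
  have ev3 : ∀ᶠ z in 𝓝 p, χ v < χ z := eventually_lt_map (by rw [hf.χp]; exact hχv1)
  filter_upwards [ev1, ev2, ev3] with z h1 h2 h3 hz
  have hd : 0 < χ z - χ v := by linarith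
  have hr1 : 1 < r z := by simp only [r]; rw [one_lt_div hd]; linarith
  have hr0 : 0 < r z := by linarith
  have hφY : φ (Y z) = (1 - r z) * φ z := by simp only [Y, map_lineMap, hφv]; ring
  have hneg : φ (Y z) < 0 := by rw [hφY]; nlinarith
  refine ⟨Y z, ?_, h1, hneg, ?_⟩
  · refine mem_segment_iff_lineMap.2 ⟨φ (Y z) / φ b, div_nonneg_of_nonpos hneg.le hφb.le,
      (div_le_one_of_neg hφb).2 h2.le, ?_⟩
    apply hf.inj
    · rw [map_lineMap φ u, hf.φu, div_mul_cancel₀ _ hφb.ne]; ring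
    · rw [map_lineMap χ u, hYχ z h3, hf.χu, hχb]; ring
  · refine mem_segment_iff_lineMap.2 ⟨(r z)⁻¹, by positivity, inv_le_one_of_one_le₀ hr1.le, ?_⟩
    simp only [Y]
    rw [AffineMap.lineMap_lineMap_right, inv_mul_cancel₀ hr0.ne', AffineMap.lineMap_apply_one]

/-- Around a sight line there is a convex open set without vertices off that line. -/
theorem exists_tube {V : Set Plane} (hV : V.Finite) {φ : Plane →ᵃ[ℝ] ℝ} {p u : Plane}
    (hp : φ p = 0) (hu : φ u = 0) :
    ∃ T : Set Plane, Convex ℝ T ∧ IsOpen T ∧ (∀ x ∈ V, x ∈ T → φ x = 0) ∧ p ∈ T ∧ u ∈ T := by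
  have hc : IsCompact (segment ℝ p u) := by
    rw [segment_eq_image_lineMap]
    exact isCompact_Icc.image AffineMap.lineMap_continuous
  have ho : IsOpen {x | x ∈ V ∧ φ x ≠ 0}ᶜ :=
    (hV.subset fun x hx => hx.1).isClosed.isOpen_compl
  obtain ⟨δ, hδ, hsub⟩ := hc.exists_thickening_subset_open ho (fun x hx hx' => by
    obtain ⟨t, -, -, rfl⟩ := mem_segment_iff_lineMap.1 hx
    apply hx'.2
    rw [map_lineMap, hp, hu]; ring)
  refine ⟨Metric.thickening δ (segment ℝ p u), (convex_segment p u).thickening δ,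
    Metric.isOpen_thickening, fun x hxV hxT => ?_,
    Metric.self_subset_thickening hδ _ (left_mem_segment _ _ _),
    Metric.self_subset_thickening hδ _ (right_mem_segment _ _ _)⟩
  by_contra hne
  exact hsub hxT ⟨hxV, hne⟩

namespace PolygonalSet

variable {P V : Set Plane} (hP : PolygonalSet P V)
include hP

/-- `sees_of_frame` for all points close to `p` on one side of the sight line. -/
theorem eventually_sees_of_frame {φ χ : Plane →ᵃ[ℝ] ℝ} {p u a b : Plane} (hf : IsFrame φ χ p u)
    (ha : a ∈ V) (hb : b ∈ V) (hχa : χ a = 0) (hχb : χ b = 0) (hu : u ∈ segment ℝ a b)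
    (hab : segment ℝ a b ⊆ P) (hpu : segment ℝ p u ⊆ P) :
    ∀ᶠ w : (Plane × Plane) × Plane in 𝓝 ((p, p), u), 0 < φ w.1.1 → w.1.1 ∈ P → w.1.2 ∈ P →
      w.2 ∈ segment ℝ a b → segment ℝ w.1.2 w.2 ⊆ P →
      (∀ x ∈ V, segment ℝ w.1.2 x ⊆ P → segment ℝ w.1.1 x ⊆ P) →
      (p ∉ V ∨ ∃ x ∈ V, x ∈ segment ℝ p u ∧ x ≠ p ∧ segment ℝ w.1.1 x ⊆ P) →
      ∃ y ∈ segment ℝ a b, segment ℝ w.1.1 y ⊆ P := by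
  have hp : p ∈ P := hpu (left_mem_segment _ _ _)
  obtain ⟨T, hT, hTo, hTV, hpT, huT⟩ := exists_tube hP.finite hf.φp hf.φu
  have t1 : Tendsto (fun w : (Plane × Plane) × Plane => w.1.1) (𝓝 ((p, p), u)) (𝓝 p) :=
    (continuous_fst.comp continuous_fst).tendsto ((p, p), u)
  have t2 : Tendsto (fun w : (Plane × Plane) × Plane => w.1.2) (𝓝 ((p, p), u)) (𝓝 p) :=
    (continuous_snd.comp continuous_fst).tendsto ((p, p), u)
  have t3 : Tendsto (fun w : (Plane × Plane) × Plane => w.2) (𝓝 ((p, p), u)) (𝓝 u) :=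
    continuous_snd.tendsto ((p, p), u)
  have evT := hTo.mem_nhds hpT
  have evχ : ∀ᶠ z in 𝓝 p, ∀ v ∈ V, φ v = 0 → χ v < 1 → χ v < χ z := by
    refine (eventually_all_finite hP.finite).2 fun v _ => ?_
    by_cases h : χ v < 1
    · filter_upwards [eventually_lt_map (φ := χ) (p := p) (r := χ v) (by rw [hf.χp]; exact h)]
        with z hz _ _ using hz
    · exact Eventually.of_forall fun z _ h' => absurd h' h
  have evy : ∀ᶠ z in 𝓝 p, ∀ v ∈ V, 0 < φ z → φ v = 0 → 0 < χ v → χ v < 1 →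
      ∀ b', (b' = a ∨ b' = b) → φ b' < 0 →
      ∃ y ∈ segment ℝ u b', y ∈ T ∧ φ y < 0 ∧ v ∈ segment ℝ z y := by
    refine (eventually_all_finite hP.finite).2 fun v _ => ?_
    by_cases h : φ v = 0 ∧ 0 < χ v ∧ χ v < 1
    · have key : ∀ b', χ b' = 0 → ∀ᶠ z in 𝓝 p, φ b' < 0 → 0 < φ z →
          ∃ y ∈ segment ℝ u b', y ∈ T ∧ φ y < 0 ∧ v ∈ segment ℝ z y := by
        intro b' hb'
        by_cases hn : φ b' < 0
        · filter_upwards [hf.eventually_exists_ray hTo huT h.1 h.2.1 h.2.2 hb' hn] with z hz _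
            using hz
        · exact Eventually.of_forall fun z h' => absurd h' hn
      filter_upwards [key a hχa, key b hχb] with z hza hzb hφz _ _ _ b' hb' hneg
      rcases hb' with rfl | rfl
      · exact hza hneg hφz
      · exact hzb hneg hφz
    · exact Eventually.of_forall fun z _ h1 h2 h3 => absurd ⟨h1, h2, h3⟩ h
  have evb : ∀ᶠ z in 𝓝 p, ∀ c ∈ P, φ c = 0 → 1 ≤ χ c → χ c ≤ χ z → segment ℝ c p ⊆ P := by
    have hc : Continuous fun t : ℝ => (AffineMap.lineMap u p t : Plane) :=
      AffineMap.lineMap_continuous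
    have h1 : Tendsto (fun t : ℝ => (AffineMap.lineMap u p t : Plane)) (𝓝 1) (𝓝 p) := by
      simpa using hc.tendsto 1
    obtain ⟨ε, hε, hball⟩ := Metric.eventually_nhds_iff_ball.1 (h1.eventually (hP.star p hp))
    filter_upwards [eventually_map_lt (φ := χ) (p := p) (r := 1 + ε) (by rw [hf.χp]; linarith)]
      with z hz c hcP hφc h1c hcz
    have h2 := hball (χ c) (by
      rw [Metric.mem_ball, Real.dist_eq, abs_of_nonneg (by linarith)]; linarith)
    rw [← hf.eq_lineMap hφc] at h2
    exact h2 hcP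
  filter_upwards [t1.eventually evT, t2.eventually evT, t3.eventually (hTo.mem_nhds huT),
    t1.eventually (hP.star p hp), t2.eventually (hP.star p hp),
    t2.eventually (eventually_lt_map (φ := χ) (p := p) (r := 0) (by rw [hf.χp]; norm_num)),
    t1.eventually evχ, t2.eventually evb, t1.eventually evy] with w h1 h2 h3 h4 h5 h6 h7 h8 h9
    hφ hz hz' hu' hzu' hM hw
  exact hP.sees_of_frame hf ha hb hχa hχb hu hab hpu hT hTo hTV hpT huT h1 h2 h3 (h4 hz) (h5 hz')
    hφ h6 h7 h8 (fun v hv => h9 v hv hφ) hu' hzu' hM hw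

/-- Let `p` see a point `u` of the edge `a b`. If `z'` close to `p` sees a point of the edge
close to `u`, and `z` close to `p` sees all vertices that `z'` sees, then `z` sees a point of the
edge. -/
theorem eventually_sees_near {p u a b : Plane} (ha : a ∈ V) (hb : b ∈ V) (hne : a ≠ b)
    (hp : p ∉ segment ℝ a b) (hu : u ∈ segment ℝ a b) (hab : segment ℝ a b ⊆ P)
    (hpu : segment ℝ p u ⊆ P) :
    ∀ᶠ w : (Plane × Plane) × Plane in 𝓝 ((p, p), u), w.1.1 ∈ P → w.1.2 ∈ P →
      w.2 ∈ segment ℝ a b → segment ℝ w.1.2 w.2 ⊆ P →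
      (∀ x ∈ V, segment ℝ w.1.2 x ⊆ P → segment ℝ w.1.1 x ⊆ P) →
      (p ∉ V ∨ ∃ x ∈ V, x ∈ segment ℝ p u ∧ x ≠ p ∧ segment ℝ w.1.1 x ⊆ P) →
      ∃ y ∈ segment ℝ a b, segment ℝ w.1.1 y ⊆ P := by
  have hpP : p ∈ P := hpu (left_mem_segment _ _ _)
  have t1 : Tendsto (fun w : (Plane × Plane) × Plane => w.1.1) (𝓝 ((p, p), u)) (𝓝 p) :=
    (continuous_fst.comp continuous_fst).tendsto ((p, p), u)
  have t2 : Tendsto (fun w : (Plane × Plane) × Plane => w.1.2) (𝓝 ((p, p), u)) (𝓝 p) :=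
    (continuous_snd.comp continuous_fst).tendsto ((p, p), u)
  by_cases hline : sideMap a (b - a) p = 0
  · -- `p` lies on the line through `a` and `b`, and the nearer endpoint of the edge decides
    obtain ⟨t, ht⟩ := exists_lineMap_of_sideMap_eq_zero hne hline
    have hnear : ∃ c ∈ V, c ∈ segment ℝ a b ∧ ∀ x ∈ segment ℝ a b, c ∈ segment ℝ p x := by
      rcases lt_or_ge t 0 with h | h
      · refine ⟨a, ha, left_mem_segment _ _ _, fun x hx => ?_⟩
        obtain ⟨s, h0, h1, rfl⟩ := mem_segment_iff_lineMap.1 hx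
        refine mem_segment_iff_lineMap.2 ⟨t / (t - s), div_nonneg_of_nonpos h.le (by linarith),
          (div_le_one_of_neg (by linarith)).2 (by linarith), ?_⟩
        rw [ht]
        have : t - s ≠ 0 := by linarith
        simp only [AffineMap.lineMap_apply_module']
        match_scalars <;> field_simp <;> ring
      · have h1 : 1 < t := by
          by_contra hcon
          exact hp (ht ▸ lineMap_mem_segment a b h (by linarith))
        refine ⟨b, hb, right_mem_segment _ _ _, fun x hx => ?_⟩
        obtain ⟨s, h0, h1', rfl⟩ := mem_segment_iff_lineMap.1 hx
        refine mem_segment_iff_lineMap.2 ⟨(t - 1) / (t - s), div_nonneg (by linarith)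
          (by linarith), (div_le_one (by linarith)).2 (by linarith), ?_⟩
        rw [ht]
        have : t - s ≠ 0 := by linarith
        simp only [AffineMap.lineMap_apply_module']
        match_scalars <;> field_simp <;> ring
    obtain ⟨c, hcV, hc, hcx⟩ := hnear
    filter_upwards [t2.eventually (hP.star p hpP)] with w hw hz hz' hu' hzu' hM _
    refine ⟨c, hc, hM c hcV (hP.sees_of_triangle (hw hz') hzu' ?_ (hcx _ hu'))⟩
    exact sees_of_mem (hcx _ hu')
      ((segment_subset_segment (left_mem_segment _ _ _) (hcx u hu)).trans hpu)
      ((segment_subset_segment hc hu').trans hab)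
  · obtain ⟨φ, χ, hf, hχa, hχb⟩ := exists_isFrame hu hline
    filter_upwards [hP.eventually_sees_of_frame hf ha hb hχa hχb hu hab hpu,
      hP.eventually_sees_of_frame hf.neg ha hb hχa hχb hu hab hpu,
      t1.eventually (hP.star p hpP),
      t1.eventually (eventually_lt_map (φ := χ) (p := p) (r := 0) (by rw [hf.χp]; norm_num))]
      with w h1 h2 h3 h4 hz hz' hu' hzu' hM hw
    rcases lt_trichotomy (φ w.1.1) 0 with h | h | h
    · exact h2 (by simpa using h) hz hz' hu' hzu' hM hw
    · exact ⟨u, hu, hf.sees_of_eq_zero h h4.le (h3 hz) hpu⟩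
    · exact h1 h hz hz' hu' hzu' hM hw

theorem eventually_not_sees {p a b : Plane} (h : ∀ u ∈ segment ℝ a b, ¬ segment ℝ p u ⊆ P) :
    ∀ᶠ z in 𝓝 p, ∀ u ∈ segment ℝ a b, ¬ segment ℝ z u ⊆ P := by
  have hK : IsCompact (segment ℝ a b) := by
    rw [segment_eq_image_lineMap]
    exact isCompact_Icc.image AffineMap.lineMap_continuous
  exact hK.eventually_forall_of_forall_eventually (fun u hu =>
    (isClosed_setOf_sees hP.isClosed).isOpen_compl.mem_nhds (h u hu))

/-- Local monotonicity: close to a point `p` that is not a vertex, a point that sees at least the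
vertices that another one sees also sees every edge that the other one sees. -/
theorem eventually_sees_edge_mono {p a b : Plane} (hpP : p ∈ P) (hpV : p ∉ V) (ha : a ∈ V)
    (hb : b ∈ V) (hne : a ≠ b) (hab : segment ℝ a b ⊆ P) :
    ∀ᶠ w : Plane × Plane in 𝓝 (p, p), w.1 ∈ P → w.2 ∈ P →
      (∀ x ∈ V, segment ℝ w.2 x ⊆ P → segment ℝ w.1 x ⊆ P) →
      (∃ u ∈ segment ℝ a b, segment ℝ w.2 u ⊆ P) →
      ∃ y ∈ segment ℝ a b, segment ℝ w.1 y ⊆ P := by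
  have t1 : Tendsto (fun w : Plane × Plane => w.1) (𝓝 (p, p)) (𝓝 p) :=
    continuous_fst.tendsto (p, p)
  by_cases hpe : p ∈ segment ℝ a b
  · filter_upwards [t1.eventually (hP.star p hpP)] with w hw hz _ _ _
    exact ⟨p, hpe, hw hz⟩
  have hK : IsCompact (segment ℝ a b) := by
    rw [segment_eq_image_lineMap]
    exact isCompact_Icc.image AffineMap.lineMap_continuous
  have key : ∀ᶠ w : Plane × Plane in 𝓝 (p, p), ∀ u ∈ segment ℝ a b, w.1 ∈ P → w.2 ∈ P →
      (∀ x ∈ V, segment ℝ w.2 x ⊆ P → segment ℝ w.1 x ⊆ P) → u ∈ segment ℝ a b →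
      segment ℝ w.2 u ⊆ P → ∃ y ∈ segment ℝ a b, segment ℝ w.1 y ⊆ P := by
    refine hK.eventually_forall_of_forall_eventually (fun u hu => ?_)
    by_cases hpu : segment ℝ p u ⊆ P
    · filter_upwards [hP.eventually_sees_near ha hb hne hpe hu hab hpu] with w hw hz hz' hM hu' hzu'
        using hw hz hz' hu' hzu' hM (Or.inl hpV)
    · have t : Tendsto (fun w : (Plane × Plane) × Plane => (w.1.2, w.2)) (𝓝 ((p, p), u))
          (𝓝 (p, u)) := Continuous.tendsto (by fun_prop) ((p, p), u)
      filter_upwards [t.eventually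
        ((isClosed_setOf_sees hP.isClosed).isOpen_compl.mem_nhds hpu)] with w hw _ _ _ _ h
      exact absurd h hw
  filter_upwards [key] with w hw hz hz' hM ⟨u, hu, hzu⟩ using hw u hu hz hz' hM hu hzu

/-- If `p` sees the edge `a b`, then so does every point close to `p` that sees at least the
vertices visible from `p`. -/
theorem eventually_sees_edge {p a b : Plane} (hpP : p ∈ P) (ha : a ∈ V) (hb : b ∈ V) (hne : a ≠ b)
    (hab : segment ℝ a b ⊆ P) (hsee : ∃ u ∈ segment ℝ a b, segment ℝ p u ⊆ P) :
    ∀ᶠ z in 𝓝 p, z ∈ P → (∀ x ∈ V, segment ℝ p x ⊆ P → segment ℝ z x ⊆ P) →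
      ∃ y ∈ segment ℝ a b, segment ℝ z y ⊆ P := by
  by_cases hpe : p ∈ segment ℝ a b
  · filter_upwards [hP.star p hpP] with z hz hzP _
    exact ⟨p, hpe, hz hzP⟩
  -- turn the sight line along the edge until it meets a vertex
  obtain ⟨u, hu, hpu, w, hwV, hw, hwp⟩ : ∃ u ∈ segment ℝ a b, segment ℝ p u ⊆ P ∧
      ∃ w ∈ V, w ∈ segment ℝ p u ∧ w ≠ p := by
    by_contra hcon
    push Not at hcon
    obtain ⟨u₀, hu₀, hpu₀⟩ := hsee
    have h1 : segment ℝ p a ⊆ P := by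
      refine hP.rotate hpu₀ ((segment_subset_segment hu₀ (left_mem_segment _ _ _)).trans hab) ?_
      intro t h0 h1 hs x hx hxs
      exact hcon _ (segment_subset_segment hu₀ (left_mem_segment _ _ _)
        (lineMap_mem_segment _ _ h0 h1.le)) hs x hx hxs
    have h2 := hcon a (left_mem_segment _ _ _) h1 a ha (right_mem_segment _ _ _)
    exact hpe (h2 ▸ left_mem_segment _ _ _)
  have t : Tendsto (fun z : Plane => ((z, p), u)) (𝓝 p) (𝓝 ((p, p), u)) :=
    Continuous.tendsto (by fun_prop) p
  filter_upwards [t.eventually (hP.eventually_sees_near ha hb hne hpe hu hab hpu)] with z hz hzP hM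
  exact hz hzP hpP hu hpu hM (Or.inr ⟨w, hwV, hw, hwp, hM w hwV
    ((segment_subset_segment (left_mem_segment _ _ _) hw).trans hpu)⟩)

end PolygonalSet

/-! ### The region of a polygon -/

section Region

variable {n : ℕ} {Q : Polygon Plane n}

theorem edgeSet_eq_segment (Q : Polygon Plane n) (i : Fin n) :
    Q.edgeSet ℝ i = segment ℝ (Q i) (Q (finRotate n i)) :=
  affineSegment_eq_segment ℝ _ _

theorem isClosed_edgeSet (Q : Polygon Plane n) (i : Fin n) : IsClosed (Q.edgeSet ℝ i) := by
  rw [edgeSet_eq_segment, segment_eq_image_lineMap]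
  exact (isCompact_Icc.image AffineMap.lineMap_continuous).isClosed

theorem isClosed_boundary (Q : Polygon Plane n) : IsClosed (Q.boundary ℝ) :=
  isClosed_iUnion_of_finite (isClosed_edgeSet Q)

theorem boundary_subset_region (Q : Polygon Plane n) : Q.boundary ℝ ⊆ region Q :=
  subset_union_left

theorem edgeSet_subset_region (Q : Polygon Plane n) (i : Fin n) : Q.edgeSet ℝ i ⊆ region Q :=
  (subset_iUnion _ i).trans (boundary_subset_region Q)

/-- A preconnected set that avoids the boundary and contains a point of the region lies in the
region. -/
theorem subset_region_of_preconnected {C : Set Plane} (hC : IsPreconnected C)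
    (hCB : ∀ x ∈ C, x ∉ Q.boundary ℝ) {x : Plane} (hx : x ∈ C) (hxP : x ∈ region Q) :
    C ⊆ region Q := by
  intro y hy
  refine Or.inr ⟨hCB y hy, ?_⟩
  have hb := (hxP.resolve_left (hCB x hx)).2
  have h1 : y ∈ connectedComponentIn (Q.boundary ℝ)ᶜ x :=
    hC.subset_connectedComponentIn hx hCB hy
  rwa [← connectedComponentIn_eq h1]

theorem subset_region_of_convex {C : Set Plane} (hC : Convex ℝ C)
    (hCB : ∀ x ∈ C, x ∉ Q.boundary ℝ) {x : Plane} (hx : x ∈ C) (hxP : x ∈ region Q) :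
    C ⊆ region Q :=
  subset_region_of_preconnected hC.isPreconnected hCB hx hxP

/-- A point outside the region lies in an unbounded connected set outside the region. -/
theorem exists_unbounded_of_notMem {x : Plane} (hx : x ∉ region Q) :
    ∃ C : Set Plane, IsOpen C ∧ IsPreconnected C ∧ x ∈ C ∧ ¬ Bornology.IsBounded C ∧
      ∀ y ∈ C, y ∉ region Q := by
  have hxB : x ∉ Q.boundary ℝ := fun h => hx (Or.inl h)
  refine ⟨connectedComponentIn (Q.boundary ℝ)ᶜ x,
    (isClosed_boundary Q).isOpen_compl.connectedComponentIn, isPreconnected_connectedComponentIn,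
    mem_connectedComponentIn hxB, fun h => hx (Or.inr ⟨hxB, h⟩), fun y hy hyP => ?_⟩
  exact hx (subset_region_of_preconnected isPreconnected_connectedComponentIn
    (fun z hz => connectedComponentIn_subset _ _ hz) hy hyP (mem_connectedComponentIn hxB))

theorem isClosed_region (Q : Polygon Plane n) : IsClosed (region Q) := by
  rw [← isOpen_compl_iff, isOpen_iff_mem_nhds]
  intro x hx
  obtain ⟨C, hCo, -, hxC, -, hC⟩ := exists_unbounded_of_notMem hx
  exact mem_of_superset (hCo.mem_nhds hxC) hC

theorem region_mem_nhds {x : Plane} (hx : x ∈ region Q) (hxB : x ∉ Q.boundary ℝ) :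
    region Q ∈ 𝓝 x := by
  have ho := (isClosed_boundary Q).isOpen_compl
  refine mem_of_superset (ho.connectedComponentIn.mem_nhds (mem_connectedComponentIn hxB)) ?_
  exact subset_region_of_preconnected isPreconnected_connectedComponentIn
    (fun z hz => connectedComponentIn_subset _ _ hz) (mem_connectedComponentIn hxB) hx

end Region

/-! ### Triangles -/

theorem exists_weights_of_mem_triangle {a b c x : Plane} (hx : x ∈ convexHull ℝ {a, b, c}) :
    ∃ α β γ : ℝ, 0 ≤ α ∧ 0 ≤ β ∧ 0 ≤ γ ∧ α + β + γ = 1 ∧ x = α • a + β • b + γ • c := by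
  rw [convexHull_insert (by simp), convexHull_pair, mem_convexJoin] at hx
  obtain ⟨a', ha', y, hy, hx⟩ := hx
  rw [mem_singleton_iff] at ha'
  subst ha'
  obtain ⟨s, t, hs, ht, hst, rfl⟩ := hy
  obtain ⟨q, r, hq, hr, hqr, rfl⟩ := hx
  refine ⟨q, r * s, r * t, hq, by positivity, by positivity, ?_, ?_⟩
  · linear_combination hqr + r * hst
  · module

theorem mem_triangle_of_weights {a b c : Plane} {α β γ : ℝ} (hα : 0 ≤ α) (hβ : 0 ≤ β) (hγ : 0 ≤ γ)
    (h : α + β + γ = 1) : α • a + β • b + γ • c ∈ convexHull ℝ {a, b, c} := by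
  have hS : Convex ℝ (convexHull ℝ ({a, b, c} : Set Plane)) := convex_convexHull _ _
  have hsub := subset_convexHull ℝ ({a, b, c} : Set Plane)
  rcases eq_or_lt_of_le hα with h0 | h0
  · subst h0
    rw [zero_smul, zero_add]
    exact hS (hsub (by simp)) (hsub (by simp)) hβ hγ (by linarith)
  rcases eq_or_lt_of_le (add_nonneg hβ hγ) with h1 | h1
  · have hb : β = 0 := by linarith
    have hc : γ = 0 := by linarith
    have ha : α = 1 := by linarith
    subst hb hc ha
    simpa using hsub (by simp)
  · have hy : (β / (β + γ)) • b + (γ / (β + γ)) • c ∈ convexHull ℝ ({a, b, c} : Set Plane) :=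
      hS (hsub (by simp)) (hsub (by simp)) (by positivity) (by positivity) (by field_simp)
    have := hS (hsub (by simp : a ∈ ({a, b, c} : Set Plane))) hy hα h1.le (by linarith)
    convert this using 1
    rw [smul_add, smul_smul, smul_smul, mul_div_cancel₀ _ h1.ne', mul_div_cancel₀ _ h1.ne',
      add_assoc]

/-- The frontier of a triangle is contained in its sides. -/
theorem frontier_triangle_subset (a b c : Plane) :
    frontier (convexHull ℝ {a, b, c}) ⊆ segment ℝ a b ∪ segment ℝ a c ∪ segment ℝ b c := by
  have hclosed : IsClosed (convexHull ℝ ({a, b, c} : Set Plane)) :=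
    ((Set.toFinite _).isCompact_convexHull _).isClosed
  intro x hx
  have hxh : x ∈ convexHull ℝ ({a, b, c} : Set Plane) := hclosed.frontier_subset hx
  have hxi : x ∉ interior (convexHull ℝ ({a, b, c} : Set Plane)) := hx.2
  by_cases hD : sideMap a (b - a) c = 0
  · -- a degenerate triangle is one of its sides
    have hsub : ∀ p q : Plane, ({a, b, c} : Set Plane) ⊆ segment ℝ p q → x ∈ segment ℝ p q :=
      fun p q h => convexHull_min h (convex_segment p q) hxh
    by_cases hab : a = b
    · right
      refine hsub b c ?_
      rintro y (rfl | rfl | rfl)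
      · rw [hab]; exact left_mem_segment _ _ _
      · exact left_mem_segment _ _ _
      · exact right_mem_segment _ _ _
    · obtain ⟨t, rfl⟩ := exists_lineMap_of_sideMap_eq_zero hab hD
      rcases lt_or_ge t 0 with h0 | h0
      · right
        refine hsub b _ ?_
        rintro y (rfl | rfl | rfl)
        · refine mem_segment_iff_lineMap.2 ⟨1 / (1 - t), by apply div_nonneg <;> linarith,
            (div_le_one (by linarith)).2 (by linarith), ?_⟩
          have : 1 - t ≠ 0 := by linarith
          simp only [AffineMap.lineMap_apply_module']
          match_scalars <;> field_simp <;> ring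
        · exact left_mem_segment _ _ _
        · exact right_mem_segment _ _ _
      rcases le_or_gt t 1 with h1 | h1
      · left; left
        refine hsub a b ?_
        rintro y (rfl | rfl | rfl)
        · exact left_mem_segment _ _ _
        · exact right_mem_segment _ _ _
        · exact lineMap_mem_segment _ _ h0 h1
      · left; right
        refine hsub a _ ?_
        rintro y (rfl | rfl | rfl)
        · exact left_mem_segment _ _ _
        · refine mem_segment_iff_lineMap.2 ⟨1 / t, by positivity,
            (div_le_one (by linarith)).2 h1.le, ?_⟩
          have : t ≠ 0 := by linarith
          simp only [AffineMap.lineMap_apply_module']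
          match_scalars <;> field_simp <;> ring
        · exact right_mem_segment _ _ _
  · -- the barycentric coordinates are quotients of areas
    set D := sideMap a (b - a) c with hDdef
    let la : Plane → ℝ := fun y => sideMap b (c - b) y / D
    let lb : Plane → ℝ := fun y => sideMap c (a - c) y / D
    let lc : Plane → ℝ := fun y => sideMap a (b - a) y / D
    have hla : Continuous la := (continuous_functional _).div_const _
    have hlb : Continuous lb := (continuous_functional _).div_const _
    have hlc : Continuous lc := (continuous_functional _).div_const _
    have hsum : ∀ y, la y + lb y + lc y = 1 := by
      intro y
      simp only [la, lb, lc]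
      field_simp
      rw [hDdef]
      simp only [sideMap_apply, PiLp.sub_apply]
      ring
    have hD' := hDdef
    rw [sideMap_apply] at hD'
    simp only [PiLp.sub_apply] at hD'
    have hcomb : ∀ y, y = la y • a + lb y • b + lc y • c := by
      intro y
      apply plane_ext
      · simp only [PiLp.add_apply, PiLp.smul_apply, smul_eq_mul, la, lb, lc]
        field_simp
        simp only [sideMap_apply, PiLp.sub_apply]
        linear_combination y 0 * hD'
      · simp only [PiLp.add_apply, PiLp.smul_apply, smul_eq_mul, la, lb, lc]
        field_simp
        simp only [sideMap_apply, PiLp.sub_apply]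
        linear_combination y 1 * hD'
    have hopen : IsOpen {y | 0 < la y ∧ 0 < lb y ∧ 0 < lc y} :=
      (isOpen_lt continuous_const hla).inter
        ((isOpen_lt continuous_const hlb).inter (isOpen_lt continuous_const hlc))
    have hin : {y | 0 < la y ∧ 0 < lb y ∧ 0 < lc y} ⊆ convexHull ℝ ({a, b, c} : Set Plane) := by
      rintro y ⟨h1, h2, h3⟩
      rw [hcomb y]
      exact mem_triangle_of_weights h1.le h2.le h3.le (hsum y)
    have hnot : ¬ (0 < la x ∧ 0 < lb x ∧ 0 < lc x) := fun h =>
      hxi (interior_maximal hin hopen h)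
    obtain ⟨α, β, γ, hα, hβ, hγ, hs, rfl⟩ := exists_weights_of_mem_triangle hxh
    set y := α • a + β • b + γ • c with hy
    have hα' : la y = α := by
      simp only [la]
      rw [div_eq_iff hD, hD', sideMap_apply, hy]
      simp only [PiLp.add_apply, PiLp.smul_apply, PiLp.sub_apply, smul_eq_mul]
      obtain rfl : α = 1 - β - γ := by linarith
      ring
    have hβ' : lb y = β := by
      simp only [lb]
      rw [div_eq_iff hD, hD', sideMap_apply, hy]
      simp only [PiLp.add_apply, PiLp.smul_apply, PiLp.sub_apply, smul_eq_mul]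
      obtain rfl : α = 1 - β - γ := by linarith
      ring
    have hγ' : lc y = γ := by
      simp only [lc]
      rw [div_eq_iff hD, hD', sideMap_apply, hy]
      simp only [PiLp.add_apply, PiLp.smul_apply, PiLp.sub_apply, smul_eq_mul]
      obtain rfl : α = 1 - β - γ := by linarith
      ring
    rw [hα', hβ', hγ'] at hnot
    rcases eq_or_lt_of_le hα with h | h1
    · right
      exact ⟨β, γ, hβ, hγ, by linarith, by rw [hy, ← h]; simp⟩
    rcases eq_or_lt_of_le hβ with h | h2
    · left; right
      exact ⟨α, γ, hα, hγ, by linarith, by rw [hy, ← h]; simp⟩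
    rcases eq_or_lt_of_le hγ with h | h3
    · left; left
      exact ⟨α, β, hα, hβ, by linarith, by rw [hy, ← h]; simp⟩
    · exact absurd ⟨h1, h2, h3⟩ hnot

/-- The region has no holes: a point of the triangle outside the region could be joined to infinity
outside the region, crossing a side of the triangle. -/
theorem triangle_subset_region {n : ℕ} {Q : Polygon Plane n} {a b c : Plane}
    (hab : segment ℝ a b ⊆ region Q) (hac : segment ℝ a c ⊆ region Q)
    (hbc : segment ℝ b c ⊆ region Q) : convexHull ℝ {a, b, c} ⊆ region Q := by
  have hcomp : IsCompact (convexHull ℝ ({a, b, c} : Set Plane)) :=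
    (Set.toFinite _).isCompact_convexHull _
  intro x hx
  by_contra hxP
  obtain ⟨C, -, hC, hxC, hunb, hCP⟩ := exists_unbounded_of_notMem hxP
  have hfr : frontier (convexHull ℝ ({a, b, c} : Set Plane)) ⊆ region Q :=
    (frontier_triangle_subset a b c).trans (union_subset (union_subset hab hac) hbc)
  have hint : ∀ y ∈ C, y ∈ convexHull ℝ ({a, b, c} : Set Plane) →
      y ∈ interior (convexHull ℝ ({a, b, c} : Set Plane)) := by
    intro y hy hyh
    by_contra hyi
    exact hCP y hy (hfr ⟨subset_closure hyh, hyi⟩)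
  have hsub : C ⊆ interior (convexHull ℝ ({a, b, c} : Set Plane)) := by
    refine hC.subset_left_of_subset_union isOpen_interior hcomp.isClosed.isOpen_compl
      (disjoint_compl_right.mono_left interior_subset) (fun y hy => ?_) ⟨x, hxC, hint x hxC hx⟩
    by_cases h : y ∈ convexHull ℝ ({a, b, c} : Set Plane)
    · exact Or.inl (hint y hy h)
    · exact Or.inr h
  exact hunb (hcomp.isBounded.subset (hsub.trans interior_subset))

/-! ### The region of a simple polygon is a polygonal set -/

section Simple

variable {n : ℕ} {Q : Polygon Plane n}

theorem mem_boundary_iff {x : Plane} : x ∈ Q.boundary ℝ ↔ ∃ i, x ∈ Q.edgeSet ℝ i :=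
  mem_iUnion

/-- Close to `p` only the edges containing `p` are met. -/
theorem eventually_mem_edgeSet (Q : Polygon Plane n) (p : Plane) :
    ∀ᶠ z in 𝓝 p, ∀ i, z ∈ Q.edgeSet ℝ i → p ∈ Q.edgeSet ℝ i := by
  refine eventually_all.2 fun i => ?_
  by_cases h : p ∈ Q.edgeSet ℝ i
  · exact Eventually.of_forall fun _ _ => h
  · filter_upwards [(isClosed_edgeSet Q i).isOpen_compl.mem_nhds h] with z hz hz' using
      absurd hz' hz

theorem region_star (Q : Polygon Plane n) {p : Plane} (hp : p ∈ region Q) :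
    ∀ᶠ z in 𝓝 p, z ∈ region Q → segment ℝ z p ⊆ region Q := by
  obtain ⟨r, hr, hball⟩ := Metric.eventually_nhds_iff_ball.1 (eventually_mem_edgeSet Q p)
  filter_upwards [Metric.ball_mem_nhds p hr] with z hz hzP y hy
  by_cases hyp : y = p
  · rwa [hyp]
  have hzy : segment ℝ z y ⊆ segment ℝ z p :=
    segment_subset_segment (left_mem_segment _ _ _) hy
  by_cases h : ∃ x ∈ segment ℝ z y, x ∈ Q.boundary ℝ
  · -- the boundary point `x` lies on an edge through `p`, and `y` lies between `p` and `x`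
    obtain ⟨x, hx, hxB⟩ := h
    obtain ⟨i, hi⟩ := mem_boundary_iff.1 hxB
    have hxball : x ∈ Metric.ball p r :=
      (convex_ball p r).segment_subset hz (Metric.mem_ball_self hr) (hzy hx)
    have hpi := hball x hxball i hi
    apply edgeSet_subset_region Q i
    rw [edgeSet_eq_segment] at hi hpi ⊢
    refine segment_subset_segment hi hpi ?_
    obtain ⟨s, hs0, hs1, rfl⟩ := mem_segment_iff_lineMap.1 hy
    obtain ⟨t, ht0, ht1, rfl⟩ := mem_segment_iff_lineMap.1 hx
    rw [AffineMap.lineMap_lineMap_right]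
    have hs1' : s < 1 := lt_of_le_of_ne hs1 (by rintro rfl; simp at hyp)
    have hlt : 0 < 1 - t * s := by nlinarith
    refine mem_segment_iff_lineMap.2 ⟨(s - t * s) / (1 - t * s), div_nonneg (by nlinarith) hlt.le,
      (div_le_one hlt).2 (by linarith), ?_⟩
    rw [AffineMap.lineMap_lineMap_left]
    congr 1
    have hne : 1 - t * s ≠ 0 := hlt.ne'
    have h1 : (1 - (s - t * s) / (1 - t * s)) * (1 - t * s) = 1 - s := by
      rw [sub_mul, div_mul_cancel₀ _ hne]; ring
    have h2 := div_mul_cancel₀ (s - t * s) hne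
    apply mul_right_cancel₀ hne
    linear_combination (-t * s) * h1 - h2
  · push Not at h
    exact subset_region_of_convex (convex_segment z y) h (left_mem_segment _ _ _) hzP
      (right_mem_segment _ _ _)

namespace IsSimple

variable (hQ : IsSimple Q)
include hQ

theorem finRotate_ne (i : Fin n) : finRotate n i ≠ i := by
  have h3 := hQ.three_le
  obtain ⟨m, rfl⟩ : ∃ m, n = m + 2 := ⟨n - 2, by omega⟩
  rw [finRotate_apply]
  simp

theorem vertex_ne (i : Fin n) : Q i ≠ Q (finRotate n i) := fun h =>
  hQ.finRotate_ne i (hQ.injective h).symm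

/-- Different edges meet only in vertices. -/
theorem mem_range_of_mem_edgeSet {i j : Fin n} (hij : i ≠ j) {x : Plane}
    (hi : x ∈ Q.edgeSet ℝ i) (hj : x ∈ Q.edgeSet ℝ j) : x ∈ range Q.vertices := by
  by_cases h1 : j = finRotate n i
  · have h := hQ.adjacent i
    rw [← h1] at h
    have : x ∈ ({Q j} : Set Plane) := h ▸ ⟨hi, hj⟩
    exact ⟨j, (mem_singleton_iff.1 this).symm⟩
  by_cases h2 : i = finRotate n j
  · have h := hQ.adjacent j
    rw [← h2] at h
    have : x ∈ ({Q i} : Set Plane) := h ▸ ⟨hj, hi⟩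
    exact ⟨i, (mem_singleton_iff.1 this).symm⟩
  · exact absurd hj (disjoint_left.1 (hQ.nonadjacent i j hij.symm h1 h2) hi)

/-- A vertex lies only on the two edges that start and end there. -/
theorem eq_or_eq_of_vertex_mem {i j : Fin n} (h : Q i ∈ Q.edgeSet ℝ j) :
    j = i ∨ finRotate n j = i := by
  by_contra hcon
  push Not at hcon
  have hi : Q i ∈ Q.edgeSet ℝ i := by rw [edgeSet_eq_segment]; exact left_mem_segment _ _ _
  by_cases h1 : j = finRotate n i
  · have h2 := hQ.adjacent i
    rw [← h1] at h2
    have : Q i ∈ ({Q j} : Set Plane) := h2 ▸ ⟨hi, h⟩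
    exact hcon.1 (hQ.injective (mem_singleton_iff.1 this)).symm
  · exact disjoint_left.1 (hQ.nonadjacent i j hcon.1 h1 hcon.2.symm) hi h

/-- Around a part of an edge that contains no vertex, the boundary consists of that edge. -/
theorem exists_thickening {i : Fin n} {x y : Plane} (hxy : segment ℝ x y ⊆ Q.edgeSet ℝ i)
    (hV : ∀ q ∈ segment ℝ x y, q ∉ range Q.vertices) :
    ∃ δ > 0, ∀ q ∈ Metric.thickening δ (segment ℝ x y), q ∈ Q.boundary ℝ → q ∈ Q.edgeSet ℝ i := by
  have hc : IsCompact (segment ℝ x y) := by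
    rw [segment_eq_image_lineMap]
    exact isCompact_Icc.image AffineMap.lineMap_continuous
  have ho : IsOpen (⋃ j : {j : Fin n // j ≠ i}, Q.edgeSet ℝ j)ᶜ :=
    (isClosed_iUnion_of_finite fun j : {j : Fin n // j ≠ i} =>
      isClosed_edgeSet Q (j : Fin n)).isOpen_compl
  obtain ⟨δ, hδ, hsub⟩ := hc.exists_thickening_subset_open ho (fun q hq hq' => by
    obtain ⟨⟨j, hj⟩, hqj⟩ := mem_iUnion.1 hq'
    exact hV q hq (hQ.mem_range_of_mem_edgeSet hj hqj (hxy hq)))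
  refine ⟨δ, hδ, fun q hq hqB => ?_⟩
  obtain ⟨j, hj⟩ := mem_boundary_iff.1 hqB
  by_cases h : j = i
  · rwa [← h]
  · exact absurd (mem_iUnion.2 ⟨⟨j, h⟩, hj⟩) (hsub hq)

/-- One point of the open interval of a sight line: if `x` is an inner point or the far end of a
sight line from `a` to `b` and no vertex, then points close to `x` on lines from `a` to points
`b'` of the region close to `b` belong to the region. -/
theorem eventually_lineMap_mem_region {a b : Plane} {t : ℝ} (hab : a ≠ b)
    (hs : segment ℝ a b ⊆ region Q) (hV : ∀ x ∈ range Q.vertices, x ∈ segment ℝ a b → x = a)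
    (ht0 : 0 < t) (ht1 : t ≤ 1) :
    ∀ᶠ w : Plane × ℝ in 𝓝 (b, t), w.1 ∈ region Q → w.2 ≤ 1 →
      AffineMap.lineMap a w.1 w.2 ∈ region Q := by
  set x : Plane := AffineMap.lineMap a b t with hx
  have hxs : x ∈ segment ℝ a b := lineMap_mem_segment a b ht0.le ht1
  have hxP : x ∈ region Q := hs hxs
  have hF : Continuous fun w : Plane × ℝ => (AffineMap.lineMap a w.1 w.2 : Plane) := by
    simp only [AffineMap.lineMap_apply_module']
    fun_prop
  have hFt : Tendsto (fun w : Plane × ℝ => (AffineMap.lineMap a w.1 w.2 : Plane)) (𝓝 (b, t))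
      (𝓝 x) := hF.tendsto (b, t)
  have tb : Tendsto (fun w : Plane × ℝ => w.1) (𝓝 (b, t)) (𝓝 b) := continuous_fst.tendsto (b, t)
  have tt : Tendsto (fun w : Plane × ℝ => w.2) (𝓝 (b, t)) (𝓝 t) := continuous_snd.tendsto (b, t)
  have evt : ∀ᶠ w : Plane × ℝ in 𝓝 (b, t), 0 < w.2 := tt.eventually (lt_mem_nhds ht0)
  -- no point of the segment from `x` to `b` is a vertex
  have hxV : ∀ q ∈ segment ℝ x b, q ∉ range Q.vertices := by
    intro q hq hqV
    have hqa := hV q hqV (segment_subset_segment hxs (right_mem_segment _ _ _) hq)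
    obtain ⟨s, hs0, hs1, hqs⟩ := mem_segment_iff_lineMap.1 hq
    rw [hqa, hx, AffineMap.lineMap_lineMap_left, eq_comm,
      AffineMap.lineMap_eq_left_iff] at hqs
    rcases hqs with h | h
    · exact hab h
    · nlinarith
  by_cases hxB : x ∈ Q.boundary ℝ
  swap
  · filter_upwards [hFt.eventually (region_mem_nhds hxP hxB)] with w hw _ _ using hw
  obtain ⟨i, hi⟩ := mem_boundary_iff.1 hxB
  set A := Q i with hA
  set B := Q (finRotate n i) with hB
  have hAB : A ≠ B := hQ.vertex_ne i
  have hedge : Q.edgeSet ℝ i = segment ℝ A B := edgeSet_eq_segment Q i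
  have hxV0 := hxV x (left_mem_segment _ _ _)
  have hxo : x ∈ openSegment ℝ A B := by
    rw [hedge] at hi
    refine mem_openSegment_of_ne_left_right ?_ ?_ hi
    · rintro h; exact hxV0 ⟨i, h⟩
    · rintro h; exact hxV0 ⟨_, h⟩
  set h := sideMap A (B - A) with hh
  have hedge0 : ∀ q ∈ Q.edgeSet ℝ i, h q = 0 := by
    intro q hq
    rw [hedge] at hq
    obtain ⟨s, -, -, rfl⟩ := mem_segment_iff_lineMap.1 hq
    rw [map_lineMap, hh, sideMap_self, sideMap_sub_self]; ring
  have hx0 : h x = 0 := hedge0 x hi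
  have evline : ∀ᶠ q in 𝓝 x, h q = 0 → q ∈ region Q := by
    filter_upwards [eventually_mem_segment hAB hxo] with q hq hq0
    apply edgeSet_subset_region Q i
    rw [hedge]
    exact hq (exists_lineMap_of_sideMap_eq_zero hAB hq0)
  have hx0' : (1 - t) * h a + t * h b = 0 := by rw [← map_lineMap, ← hx, hx0]
  by_cases ha0 : h a = 0
  · -- the sight line runs along the edge
    have hb0 : h b = 0 := by
      rw [ha0] at hx0'
      have : t * h b = 0 := by linarith
      exact (mul_eq_zero.1 this).resolve_left ht0.ne'
    have hbe : b ∈ segment ℝ A B := by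
      obtain ⟨β, hβ⟩ := exists_lineMap_of_sideMap_eq_zero hAB hb0
      rw [openSegment_eq_image_lineMap] at hxo
      obtain ⟨ξ, ⟨hξ0, hξ1⟩, hξ⟩ := hxo
      rw [hβ]
      refine lineMap_mem_segment _ _ ?_ ?_
      · by_contra hcon
        push Not at hcon
        refine hxV A ?_ ⟨i, rfl⟩
        have hd : 0 < ξ - β := by linarith
        refine mem_segment_iff_lineMap.2 ⟨ξ / (ξ - β), by positivity,
          (div_le_one hd).2 (by linarith), ?_⟩
        rw [hβ, ← hξ]
        simp only [AffineMap.lineMap_apply_module']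
        match_scalars <;> field_simp <;> ring
      · by_contra hcon
        push Not at hcon
        refine hxV B ?_ ⟨_, rfl⟩
        have hd : 0 < β - ξ := by linarith
        refine mem_segment_iff_lineMap.2 ⟨(1 - ξ) / (β - ξ), div_nonneg (by linarith) hd.le,
          (div_le_one hd).2 (by linarith), ?_⟩
        rw [hβ, ← hξ]
        simp only [AffineMap.lineMap_apply_module']
        match_scalars <;> field_simp <;> ring
    have hxb : segment ℝ x b ⊆ Q.edgeSet ℝ i := by
      rw [hedge] at hi ⊢
      exact segment_subset_segment hi hbe
    obtain ⟨δ, hδ, hthick⟩ := hQ.exists_thickening hxb hxV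
    have hTo : IsOpen (Metric.thickening δ (segment ℝ x b)) := Metric.isOpen_thickening
    have hTc := (convex_segment x b).thickening δ
    have hxT := Metric.self_subset_thickening hδ _ (left_mem_segment ℝ x b)
    have hbT := Metric.self_subset_thickening hδ _ (right_mem_segment ℝ x b)
    filter_upwards [hFt.eventually (hTo.mem_nhds hxT), tb.eventually (hTo.mem_nhds hbT),
      hFt.eventually evline, evt] with w h1 h2 h3 h4 hwP _
    have hw : h (AffineMap.lineMap a w.1 w.2) = w.2 * h w.1 := by rw [map_lineMap, ha0]; ring
    by_cases hb' : h w.1 = 0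
    · exact h3 (by rw [hw, hb', mul_zero])
    · refine subset_region_of_convex (convex_segment (AffineMap.lineMap a w.1 w.2) w.1) ?_
        (right_mem_segment _ _ _) hwP (left_mem_segment _ _ _)
      intro q hq hqB
      have hq0 := hedge0 q (hthick q (hTc.segment_subset h1 h2 hq) hqB)
      obtain ⟨s, hs0, hs1, rfl⟩ := mem_segment_iff_lineMap.1 hq
      rw [map_lineMap, hw] at hq0
      have h5 : ((1 - s) * w.2 + s) * h w.1 = 0 := by linarith
      rcases mul_eq_zero.1 h5 with h6 | h6
      · rcases eq_or_lt_of_le hs0 with h7 | h7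
        · rw [← h7] at h6; linarith
        · nlinarith
      · exact hb' h6
  · -- the sight line is transversal to the edge; `g` is positive on the side of `a`
    obtain ⟨g, hga, hgh⟩ : ∃ g : Plane →ᵃ[ℝ] ℝ, 0 < g a ∧ ∀ q, g q = 0 ↔ h q = 0 := by
      rcases lt_or_gt_of_ne ha0 with h1 | h1
      · exact ⟨-h, by simpa using h1, fun q => by simp⟩
      · exact ⟨h, h1, fun q => Iff.rfl⟩
    have hxx : segment ℝ x x ⊆ Q.edgeSet ℝ i := by simpa using hi
    obtain ⟨δ, hδ, hthick⟩ := hQ.exists_thickening hxx (by simpa using hxV0)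
    rw [segment_same, Metric.thickening_singleton] at hthick
    obtain ⟨δ', hδ', hline⟩ := Metric.eventually_nhds_iff_ball.1 evline
    set ρ := min δ δ' with hρ
    have hρ0 : 0 < ρ := lt_min hδ hδ'
    have hball : ∀ q ∈ Metric.ball x ρ, q ∈ Q.boundary ℝ → g q = 0 := fun q hq hqB =>
      (hgh q).2 (hedge0 q (hthick q (Metric.ball_subset_ball (min_le_left _ _) hq) hqB))
    have hline' : ∀ q ∈ Metric.ball x ρ, g q = 0 → q ∈ region Q := fun q hq hq0 =>
      hline q (Metric.ball_subset_ball (min_le_right _ _) hq) ((hgh q).1 hq0)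
    have hgx : g x = 0 := (hgh x).2 hx0
    have hgx' : (1 - t) * g a + t * g b = 0 := by rw [← map_lineMap, ← hx, hgx]
    have hside : ∀ S : Set ℝ, Convex ℝ S → (0 : ℝ) ∉ S → ∀ q ∈ Metric.ball x ρ, g q ∈ S →
        q ∈ region Q → ∀ q' ∈ Metric.ball x ρ, g q' ∈ S → q' ∈ region Q := by
      intro S hS hS0 q hq hqS hqP q' hq' hqS'
      refine subset_region_of_convex ((convex_ball x ρ).inter (hS.affine_preimage g)) ?_
        ⟨hq, hqS⟩ hqP ⟨hq', hqS'⟩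
      rintro y ⟨hy, hyS⟩ hyB
      apply hS0
      rw [← hball y hy hyB]
      exact hyS
    have hpos : ∀ q ∈ Metric.ball x ρ, 0 < g q → q ∈ region Q := by
      obtain ⟨s, hs1, hs0, hs2⟩ := ((eventually_lineMap_mem (b := a)
        (Metric.ball_mem_nhds x hρ0)).and eventually_pos_lt_one).exists
      refine hside (Ioi 0) (convex_Ioi 0) (by simp) _ hs1 ?_ ?_
      · rw [mem_Ioi, map_lineMap, hgx]; nlinarith
      · exact hs (segment_subset_segment hxs (left_mem_segment _ _ _)
          (lineMap_mem_segment _ _ hs0.le hs2.le))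
    rcases eq_or_lt_of_le ht1 with h1 | h1
    · -- `x = b` is the end of the sight line
      have hxb : x = b := by rw [hx, h1, AffineMap.lineMap_apply_one]
      filter_upwards [hFt.eventually (Metric.ball_mem_nhds x hρ0),
        tb.eventually (hxb ▸ Metric.ball_mem_nhds x hρ0), evt] with w h2 h3 h4 hwP hw1
      rcases lt_trichotomy (g (AffineMap.lineMap a w.1 w.2)) 0 with h5 | h5 | h5
      · refine hside (Iio 0) (convex_Iio 0) (by simp) w.1 (by rw [hxb]; exact h3) ?_ hwP _ h2 h5
        rw [map_lineMap] at h5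
        rw [mem_Iio]
        nlinarith
      · exact hline' _ h2 h5
      · exact hpos _ h2 h5
    · -- the sight line crosses the edge
      have hgb : g b < 0 := by nlinarith
      have hneg : ∀ q ∈ Metric.ball x ρ, g q < 0 → q ∈ region Q := by
        obtain ⟨s, hs1, hs0, hs2⟩ := ((eventually_lineMap_mem (b := b)
          (Metric.ball_mem_nhds x hρ0)).and eventually_pos_lt_one).exists
        refine hside (Iio 0) (convex_Iio 0) (by simp) _ hs1 ?_ ?_
        · rw [mem_Iio, map_lineMap, hgx]; nlinarith
        · exact hs (segment_subset_segment hxs (right_mem_segment _ _ _)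
            (lineMap_mem_segment _ _ hs0.le hs2.le))
      filter_upwards [hFt.eventually (Metric.ball_mem_nhds x hρ0)] with w h2 _ _
      rcases lt_trichotomy (g (AffineMap.lineMap a w.1 w.2)) 0 with h5 | h5 | h5
      · exact hneg _ h2 h5
      · exact hline' _ h2 h5
      · exact hpos _ h2 h5

/-- A sight line without vertices, except possibly at its start, can be turned about its start. -/
theorem region_stable {a b : Plane} (hs : segment ℝ a b ⊆ region Q)
    (hV : ∀ x ∈ range Q.vertices, x ∈ segment ℝ a b → x = a) :
    ∀ᶠ b' in 𝓝 b, b' ∈ region Q → segment ℝ a b' ⊆ region Q := by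
  have haP : a ∈ region Q := hs (left_mem_segment _ _ _)
  by_cases hab : a = b
  · subst hab
    filter_upwards [region_star Q haP] with b' h hb'
    rw [segment_symm]
    exact h hb'
  obtain ⟨τ, hτ, hτ0, hτ1⟩ := ((eventually_lineMap_mem (b := b)
    (eventually_eventually_nhds.2 (region_star Q haP))).and eventually_pos_lt_one).exists
  have hc : Continuous fun b' : Plane => (AffineMap.lineMap a b' τ : Plane) := by
    simp only [AffineMap.lineMap_apply_module']
    fun_prop
  have hnear : ∀ᶠ b' in 𝓝 b, AffineMap.lineMap a b' τ ∈ region Q →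
      segment ℝ (AffineMap.lineMap a b' τ) a ⊆ region Q := (hc.tendsto b).eventually hτ
  have hfar : ∀ᶠ b' in 𝓝 b, ∀ t ∈ Icc τ 1, b' ∈ region Q → t ≤ 1 →
      AffineMap.lineMap a b' t ∈ region Q :=
    isCompact_Icc.eventually_forall_of_forall_eventually (fun t ht =>
      hQ.eventually_lineMap_mem_region hab hs hV (hτ0.trans_le ht.1) ht.2)
  filter_upwards [hnear, hfar] with b' h1 h2 hb'
  have h3 := h1 (h2 τ ⟨le_rfl, hτ1.le⟩ hb' hτ1.le)
  intro y hy
  obtain ⟨t, ht0, ht1, rfl⟩ := mem_segment_iff_lineMap.1 hy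
  rcases le_total t τ with h | h
  · apply h3
    rw [segment_symm]
    refine mem_segment_iff_lineMap.2 ⟨t / τ, by positivity, (div_le_one hτ0).2 h, ?_⟩
    rw [AffineMap.lineMap_lineMap_right, div_mul_cancel₀ _ hτ0.ne']
  · exact h2 t ⟨h, ht1⟩ hb' ht1

end IsSimple

end Simple

section Simple

variable {n : ℕ} {Q : Polygon Plane n}

/-- A line through `v` all of whose points close to `v` lie in the region, where close to `v` the
boundary consists of two segments `v F₁` and `v F₂` lying strictly on different sides of the line:
then the whole negative side is free. -/
theorem eventually_mem_region_of_separated {v F₁ F₂ x y : Plane} {ρ : ℝ} (hρ : 0 < ρ)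
    (hB : ∀ q ∈ Metric.ball v ρ, q ∈ Q.boundary ℝ → q ∈ segment ℝ v F₁ ∨ q ∈ segment ℝ v F₂)
    (hF₁ : segment ℝ v F₁ ⊆ region Q) {ψ : Plane →ᵃ[ℝ] ℝ} (hv : v ∈ openSegment ℝ x y) (hxy : x ≠ y)
    (hs : segment ℝ x y ⊆ region Q) (hψx : ψ x = 0) (hψy : ψ y = 0) (h₁ : ψ F₁ < 0)
    (h₂ : 0 < ψ F₂) : ∀ᶠ q in 𝓝 v, ψ q < 0 → q ∈ region Q := by
  have hψv : ψ v = 0 := by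
    rw [openSegment_eq_image_lineMap] at hv
    obtain ⟨t, -, rfl⟩ := hv
    rw [map_lineMap, hψx, hψy]; ring
  -- the projection to the line in the direction of `F₁`
  let β : Plane → ℝ := fun q => ψ q / ψ F₁
  let pr : Plane → Plane := fun q => q - β q • (F₁ - v)
  have hβ : Continuous β := (continuous_functional ψ).div_const _
  have hpr : Continuous pr := by fun_prop
  have hβv : β v = 0 := by simp [β, hψv]
  have hprv : pr v = v := by simp [pr, hβv]
  have hψpr : ∀ q, ψ (pr q) = 0 := by
    intro q
    have e1 : pr q = (-(β q) • (F₁ - v)) +ᵥ q := by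
      simp only [pr, vadd_eq_add, neg_smul]; abel
    have e2 : ψ.linear (F₁ - v) = ψ F₁ - ψ v := by simpa using ψ.linearMap_vsub F₁ v
    rw [e1, AffineMap.map_vadd, map_smul, e2, hψv]
    simp only [β, vadd_eq_add, smul_eq_mul]
    have := h₁.ne
    field_simp
    ring
  have ev1 : ∀ᶠ q in 𝓝 v, pr q ∈ Metric.ball v ρ :=
    hpr.continuousAt.eventually (by rw [hprv]; exact Metric.ball_mem_nhds v hρ)
  have ev2 : ∀ᶠ q in 𝓝 v, (∃ t : ℝ, pr q = AffineMap.lineMap x y t) → pr q ∈ segment ℝ x y :=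
    hpr.continuousAt.eventually (by rw [hprv]; exact eventually_mem_segment hxy hv)
  have ev3 : ∀ᶠ q in 𝓝 v, β q < 1 :=
    hβ.continuousAt.eventually (gt_mem_nhds (by rw [hβv]; norm_num))
  filter_upwards [ev1, ev2, ev3, Metric.ball_mem_nhds v hρ] with q h3 h4 h5 h6 hq
  have hβ0 : 0 < β q := div_pos_of_neg_of_neg hq h₁
  have hqpr : q = pr q + β q • (F₁ - v) := by simp [pr]
  by_cases hpv : pr q = v
  · apply hF₁
    refine mem_segment_iff_lineMap.2 ⟨β q, hβ0.le, h5.le, ?_⟩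
    rw [AffineMap.lineMap_apply_module', add_comm, ← hpv]
    conv_lhs => rw [hqpr]
    rw [hpv]
  have hprP : pr q ∈ region Q :=
    hs (h4 (exists_lineMap_of_eq_zero hxy hψx hψy h₁.ne (hψpr q)))
  -- the segment from the projection to `q` avoids the boundary
  refine subset_region_of_convex (convex_segment (pr q) q) ?_ (left_mem_segment _ _ _) hprP
    (right_mem_segment _ _ _)
  intro c hc hcB
  have hcb := (convex_ball v ρ).segment_subset h3 h6 hc
  obtain ⟨s, hs0, hs1, rfl⟩ := mem_segment_iff_lineMap.1 hc
  have hψc : ψ (AffineMap.lineMap (pr q) q s) = s * ψ q := by rw [map_lineMap, hψpr]; ring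
  rcases hB _ hcb hcB with h | h
  · obtain ⟨r, hr0, hr1, hr⟩ := mem_segment_iff_lineMap.1 h
    have e1 : s * ψ q = r * ψ F₁ := by rw [← hψc, hr, map_lineMap, hψv]; ring
    have e2 : r = s * β q := by
      simp only [β]
      rw [← mul_div_assoc, e1, mul_div_cancel_right₀ _ h₁.ne]
    apply hpv
    rw [AffineMap.lineMap_apply_module', AffineMap.lineMap_apply_module', e2] at hr
    have e3 : q - pr q = β q • (F₁ - v) := by simp [pr]
    rw [e3, smul_smul] at hr
    exact add_left_cancel hr
  · obtain ⟨r, hr0, hr1, hr⟩ := mem_segment_iff_lineMap.1 h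
    have e1 : s * ψ q = r * ψ F₂ := by rw [← hψc, hr, map_lineMap, hψv]; ring
    have e2 : r = 0 := by
      by_contra hne
      have : 0 < r := lt_of_le_of_ne hr0 (Ne.symm hne)
      nlinarith
    have e3 : s = 0 := by
      rw [e2, zero_mul] at e1
      exact (mul_eq_zero.1 e1).resolve_right hq.ne
    rw [e2, e3, AffineMap.lineMap_apply_zero, AffineMap.lineMap_apply_zero] at hr
    exact hpv hr

/-- A line through `v` inside the region, where close to `v` the boundary consists of two segments
`v F₁` and `v F₂` on the closed nonnegative side of the line. -/
theorem eventually_mem_region_of_nonneg {v F₁ F₂ x y w : Plane} {ρ : ℝ} (hρ : 0 < ρ)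
    (hB : ∀ q ∈ Metric.ball v ρ, q ∈ Q.boundary ℝ → q ∈ segment ℝ v F₁ ∨ q ∈ segment ℝ v F₂)
    {ψ : Plane →ᵃ[ℝ] ℝ} (hv : v ∈ openSegment ℝ x y) (hxy : x ≠ y)
    (hs : segment ℝ x y ⊆ region Q) (hψx : ψ x = 0) (hψy : ψ y = 0)
    (hw : segment ℝ v w ⊆ region Q) (hψw : ψ w ≠ 0) (h₁ : 0 ≤ ψ F₁) (h₂ : 0 ≤ ψ F₂) :
    (∀ᶠ q in 𝓝 v, 0 < ψ q → q ∈ region Q) ∨ (∀ᶠ q in 𝓝 v, ψ q < 0 → q ∈ region Q) := by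
  have hvs : v ∈ segment ℝ x y := openSegment_subset_segment _ _ _ hv
  have hψv : ψ v = 0 := by
    obtain ⟨t, -, -, rfl⟩ := mem_segment_iff_lineMap.1 hvs
    rw [map_lineMap, hψx, hψy]; ring
  have hvy : v ≠ y := by
    rintro rfl
    exact hxy (right_mem_openSegment_iff.1 hv)
  by_cases hneg : ∃ q ∈ Metric.ball v ρ, ψ q < 0 ∧ q ∈ region Q
  · right
    obtain ⟨q, hqb, hq0, hqP⟩ := hneg
    filter_upwards [Metric.ball_mem_nhds v hρ] with q' hq'b hq'0
    refine subset_region_of_convex ((convex_ball v ρ).inter ((convex_Iio 0).affine_preimage ψ)) ?_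
      ⟨hqb, hq0⟩ hqP ⟨hq'b, hq'0⟩
    rintro c ⟨hcb, hc0⟩ hcB
    rw [mem_preimage, mem_Iio] at hc0
    rcases hB c hcb hcB with h | h
    · obtain ⟨r, hr0, -, rfl⟩ := mem_segment_iff_lineMap.1 h
      rw [map_lineMap, hψv] at hc0
      nlinarith
    · obtain ⟨r, hr0, -, rfl⟩ := mem_segment_iff_lineMap.1 h
      rw [map_lineMap, hψv] at hc0
      nlinarith
  push Not at hneg
  -- otherwise the line consists of boundary points near `v`, in both directions
  have hline : ∀ q ∈ Metric.ball v ρ, ψ q = 0 → q ∈ region Q → q ∈ Q.boundary ℝ := by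
    intro q hqb hq0 hqP
    by_contra hqB
    have hnhds := inter_mem (region_mem_nhds hqP hqB) (Metric.isOpen_ball.mem_nhds hqb)
    -- a point with `ψ < 0`, reached from `q` in a direction in which `ψ` decreases
    have hk : ∃ d : Plane, ψ.linear d < 0 := by
      have e2 : ψ.linear (w - v) = ψ w - ψ v := by simpa using ψ.linearMap_vsub w v
      rcases lt_or_gt_of_ne hψw with h | h
      · exact ⟨w - v, by rw [e2, hψv]; linarith⟩
      · exact ⟨-(w - v), by rw [map_neg, e2, hψv]; linarith⟩
    obtain ⟨d, hd⟩ := hk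
    obtain ⟨s, hs1, hs0, -⟩ := ((eventually_lineMap_mem (b := d +ᵥ q) hnhds).and
      eventually_pos_lt_one).exists
    refine hneg _ hs1.2 ?_ hs1.1
    rw [map_lineMap, AffineMap.map_vadd, hq0, vadd_eq_add]
    nlinarith
  let χ : Plane →ᵃ[ℝ] ℝ := sideMap v (!₂[(y - v) 1, -(y - v) 0])
  have hχv : χ v = 0 := sideMap_self _ _
  have hχy : 0 < χ y := by
    have h1 : χ y = (y - v) 1 ^ 2 + (y - v) 0 ^ 2 := by
      simp only [χ, sideMap_apply, PiLp.sub_apply, Matrix.cons_val_zero, Matrix.cons_val_one]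
      ring
    rw [h1]
    by_contra hcon
    push Not at hcon
    apply hvy
    have h2 : (y - v) 0 = 0 := by nlinarith [sq_nonneg ((y - v) 0), sq_nonneg ((y - v) 1)]
    have h3 : (y - v) 1 = 0 := by nlinarith [sq_nonneg ((y - v) 0), sq_nonneg ((y - v) 1)]
    rw [PiLp.sub_apply, sub_eq_zero] at h2 h3
    exact (plane_ext h2 h3).symm
  have hχx : χ x < 0 := by
    rw [openSegment_eq_image_lineMap] at hv
    obtain ⟨t, ⟨ht0, ht1⟩, ht⟩ := hv
    rw [← ht, map_lineMap] at hχv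
    nlinarith
  have key : ∀ p, p ∈ segment ℝ x y → χ p ≠ 0 → ∃ F, (F = F₁ ∨ F = F₂) ∧ ψ F = 0 ∧
      0 < χ F * χ p := by
    intro p hp hχp
    obtain ⟨s, hsb, hs0, hs1⟩ := ((eventually_lineMap_mem (b := p)
      (Metric.ball_mem_nhds v hρ)).and eventually_pos_lt_one).exists
    have hψp : ψ p = 0 := by
      obtain ⟨t, -, -, rfl⟩ := mem_segment_iff_lineMap.1 hp
      rw [map_lineMap, hψx, hψy]; ring
    have hψq : ψ (AffineMap.lineMap v p s) = 0 := by rw [map_lineMap, hψp, hψv]; ring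
    have hχq : χ (AffineMap.lineMap v p s) = s * χ p := by rw [map_lineMap, hχv]; ring
    have hqP := hs (segment_subset_segment hvs hp (lineMap_mem_segment v p hs0.le hs1.le))
    have hF : ∀ F, AffineMap.lineMap v p s ∈ segment ℝ v F → ψ F = 0 ∧ 0 < χ F * χ p := by
      intro F hF
      obtain ⟨r, hr0, hr1, hr⟩ := mem_segment_iff_lineMap.1 hF
      rw [hr, map_lineMap, hψv] at hψq
      rw [hr, map_lineMap, hχv] at hχq
      have hsq : 0 < χ p ^ 2 := by positivity
      have hr' : 0 < r := by
        refine lt_of_le_of_ne hr0 ?_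
        rintro rfl
        have : s * χ p = 0 := by linarith
        rcases mul_eq_zero.1 this with h | h
        · linarith
        · exact hχp h
      constructor
      · have : r * ψ F = 0 := by linarith
        exact (mul_eq_zero.1 this).resolve_left hr'.ne'
      · have h1 : r * (χ F * χ p) = s * χ p ^ 2 := by
          linear_combination χ p * hχq
        have h2 : 0 < s * χ p ^ 2 := by positivity
        rw [← h1] at h2
        exact (mul_pos_iff_of_pos_left hr').1 h2
    rcases hB _ hsb (hline _ hsb hψq hqP) with h | h
    · exact ⟨F₁, Or.inl rfl, hF _ h⟩
    · exact ⟨F₂, Or.inr rfl, hF _ h⟩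
  obtain ⟨F, hF, hψF, hχF⟩ := key y (right_mem_segment _ _ _) hχy.ne'
  obtain ⟨F', hF', hψF', hχF'⟩ := key x (left_mem_segment _ _ _) hχx.ne
  have hFpos : 0 < χ F := (pos_iff_pos_of_mul_pos hχF).2 hχy
  have hFneg : χ F' < 0 := by nlinarith
  have h0 : ψ F₁ = 0 ∧ ψ F₂ = 0 := by
    rcases hF with rfl | rfl <;> rcases hF' with rfl | rfl
    · linarith
    · exact ⟨hψF, hψF'⟩
    · exact ⟨hψF', hψF⟩
    · linarith
  left
  -- the positive side avoids the boundary and contains points of the region on the way to `w`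
  obtain ⟨s, hsb, hs0, hs1⟩ := ((eventually_lineMap_mem (b := w)
    (Metric.ball_mem_nhds v hρ)).and eventually_pos_lt_one).exists
  have hqP := hw (lineMap_mem_segment v w hs0.le hs1.le)
  have hψq : ψ (AffineMap.lineMap v w s) = s * ψ w := by rw [map_lineMap, hψv]; ring
  have hq0 : 0 < ψ (AffineMap.lineMap v w s) := by
    rcases lt_or_gt_of_ne hψw with h | h
    · exact absurd hqP (hneg _ hsb (by rw [hψq]; nlinarith))
    · rw [hψq]; positivity
  filter_upwards [Metric.ball_mem_nhds v hρ] with q' hq'b hq'0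
  refine subset_region_of_convex ((convex_ball v ρ).inter ((convex_Ioi 0).affine_preimage ψ)) ?_
    ⟨hsb, hq0⟩ hqP ⟨hq'b, hq'0⟩
  rintro c ⟨hcb, hc0⟩ hcB
  rw [mem_preimage, mem_Ioi] at hc0
  rcases hB c hcb hcB with h | h
  · obtain ⟨r, hr0, -, rfl⟩ := mem_segment_iff_lineMap.1 h
    rw [map_lineMap, hψv, h0.1] at hc0
    linarith
  · obtain ⟨r, hr0, -, rfl⟩ := mem_segment_iff_lineMap.1 h
    rw [map_lineMap, hψv, h0.2] at hc0
    linarith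

/-- A line through a vertex inside the region is obstructed at that vertex from one side at most,
because only two edges meet there. -/
theorem IsSimple.region_oneSide (hQ : IsSimple Q) {v : Plane} (hvV : v ∈ range Q.vertices)
    (ψ : Plane →ᵃ[ℝ] ℝ) {x y w : Plane} (hv : v ∈ openSegment ℝ x y) (hxy : x ≠ y)
    (hs : segment ℝ x y ⊆ region Q) (hψx : ψ x = 0) (hψy : ψ y = 0)
    (hw : segment ℝ v w ⊆ region Q) (hψw : ψ w ≠ 0) :
    (∀ᶠ q in 𝓝 v, 0 < ψ q → q ∈ region Q) ∨ (∀ᶠ q in 𝓝 v, ψ q < 0 → q ∈ region Q) := by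
  obtain ⟨i, rfl⟩ := hvV
  set F₁ := Q (finRotate n i)
  set F₂ := Q ((finRotate n).symm i)
  have hF₁ : segment ℝ (Q i) F₁ ⊆ region Q := by
    have := edgeSet_subset_region Q i
    rwa [edgeSet_eq_segment] at this
  have hF₂ : segment ℝ (Q i) F₂ ⊆ region Q := by
    have := edgeSet_subset_region Q ((finRotate n).symm i)
    rwa [edgeSet_eq_segment, Equiv.apply_symm_apply, segment_symm] at this
  obtain ⟨ρ, hρ, hball⟩ := Metric.eventually_nhds_iff_ball.1 (eventually_mem_edgeSet Q (Q i))
  have hB : ∀ q ∈ Metric.ball (Q i) ρ, q ∈ Q.boundary ℝ →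
      q ∈ segment ℝ (Q i) F₁ ∨ q ∈ segment ℝ (Q i) F₂ := by
    intro q hq hqB
    obtain ⟨j, hj⟩ := mem_boundary_iff.1 hqB
    rcases hQ.eq_or_eq_of_vertex_mem (hball q hq j hj) with rfl | h
    · left; rwa [edgeSet_eq_segment] at hj
    · right
      have hj' : j = (finRotate n).symm i := by rw [← h, Equiv.symm_apply_apply]
      rw [edgeSet_eq_segment, h, hj', segment_symm] at hj
      exact hj
  have hBs : ∀ q ∈ Metric.ball (Q i) ρ, q ∈ Q.boundary ℝ →
      q ∈ segment ℝ (Q i) F₂ ∨ q ∈ segment ℝ (Q i) F₁ := fun q hq hqB => (hB q hq hqB).symm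
  have hψw' : (-ψ) w ≠ 0 := by simpa using hψw
  by_cases h1 : 0 ≤ ψ F₁ <;> by_cases h2 : 0 ≤ ψ F₂
  · exact eventually_mem_region_of_nonneg hρ hB hv hxy hs hψx hψy hw hψw h1 h2
  · push Not at h2
    rcases eq_or_lt_of_le h1 with h1 | h1
    · have := eventually_mem_region_of_nonneg (ψ := -ψ) hρ hB hv hxy hs (by simp [hψx])
        (by simp [hψy]) hw hψw' (by simp [← h1]) (by simpa using h2.le)
      simpa [or_comm] using this
    · exact Or.inr (eventually_mem_region_of_separated hρ hBs hF₂ hv hxy hs hψx hψy h2 h1)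
  · push Not at h1
    rcases eq_or_lt_of_le h2 with h2 | h2
    · have := eventually_mem_region_of_nonneg (ψ := -ψ) hρ hB hv hxy hs (by simp [hψx])
        (by simp [hψy]) hw hψw' (by simpa using h1.le) (by simp [← h2])
      simpa [or_comm] using this
    · exact Or.inr (eventually_mem_region_of_separated hρ hB hF₁ hv hxy hs hψx hψy h1 h2)
  · push Not at h1 h2
    have := eventually_mem_region_of_nonneg (ψ := -ψ) hρ hB hv hxy hs (by simp [hψx])
      (by simp [hψy]) hw hψw' (by simpa using h1.le) (by simpa using h2.le)
    simpa [or_comm] using this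

theorem IsSimple.polygonalSet (hQ : IsSimple Q) : PolygonalSet (region Q) (range Q.vertices) where
  finite := finite_range _
  isClosed := isClosed_region Q
  star _ hp := region_star Q hp
  triangle _ _ _ hab hac hbc := triangle_subset_region hab hac hbc
  stable _ _ hs hV := hQ.region_stable hs hV
  oneSide _ hv ψ _ _ _ hvo hxy hs hx hy hw hψw :=
    hQ.region_oneSide hv ψ hvo hxy hs hx hy hw hψw

end Simple

/-! ### Visibility regions -/

section Regions

variable {n : ℕ} {Q : Polygon Plane n}

theorem IsUniform.visibilitySet_eq {R : Set Plane} (hR : IsUniform Q R) {x : Plane} (hx : x ∈ R) :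
    visibilitySet Q R = visibleVertices Q x := by
  ext i
  refine ⟨fun h => h x hx, fun h y hy => ?_⟩
  have : i ∈ visibleVertices Q y := hR.2.2 x hx y hy ▸ h
  exact this

/-- A uniform set meeting a visibility region is contained in it. -/
theorem IsVisibilityRegion.subset {R U : Set Plane} (hR : IsVisibilityRegion Q R)
    (hU : IsUniform Q U) (h : (R ∩ U).Nonempty) : U ⊆ R := by
  obtain ⟨x, hxR, hxU⟩ := h
  have hx : ∀ y ∈ R ∪ U, visibleVertices Q y = visibleVertices Q x := by
    rintro y (hy | hy)
    · exact hR.prop.2.2 y hy x hxR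
    · exact hU.2.2 y hy x hxU
  have hun : IsUniform Q (R ∪ U) :=
    ⟨union_subset hR.prop.1 hU.1, hR.prop.2.1.union ⟨x, hxR, hxU⟩ hU.2.1,
      fun y hy z hz => (hx y hy).trans (hx z hz).symm⟩
  exact subset_union_right.trans (hR.le_of_ge hun subset_union_left)

theorem IsVisibilityRegion.eq {R R' : Set Plane} (hR : IsVisibilityRegion Q R)
    (hR' : IsVisibilityRegion Q R') (h : (R ∩ R').Nonempty) : R = R' :=
  Subset.antisymm (hR'.subset hR.prop (by rwa [inter_comm])) (hR.subset hR'.prop h)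

theorem exists_visibilityRegion {x : Plane} (hx : x ∈ region Q) :
    ∃ R, IsVisibilityRegion Q R ∧ x ∈ R := by
  set S : Set Plane := {y | y ∈ region Q ∧ visibleVertices Q y = visibleVertices Q x} with hS
  have hxS : x ∈ S := ⟨hx, rfl⟩
  have hsub : connectedComponentIn S x ⊆ S := connectedComponentIn_subset S x
  refine ⟨connectedComponentIn S x, ⟨⟨fun y hy => (hsub hy).1,
    ⟨⟨x, mem_connectedComponentIn hxS⟩, isPreconnected_connectedComponentIn⟩,
    fun y hy z hz => (hsub hy).2.trans (hsub hz).2.symm⟩, ?_⟩, mem_connectedComponentIn hxS⟩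
  intro R' hR' hle
  have hxR' := hle (mem_connectedComponentIn hxS)
  exact hR'.2.1.isPreconnected.subset_connectedComponentIn hxR'
    fun y hy => ⟨hR'.1 hy, hR'.2.2 y hy x hxR'⟩

theorem weaklyVisible_iff {z : Plane} {e : Fin n} :
    WeaklyVisible Q z e ↔
      ∃ u ∈ segment ℝ (Q e) (Q (finRotate n e)), segment ℝ z u ⊆ region Q := by
  rw [WeaklyVisible, edgeSet_eq_segment]
  rfl

theorem edge_subset_region (Q : Polygon Plane n) (e : Fin n) :
    segment ℝ (Q e) (Q (finRotate n e)) ⊆ region Q := by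
  have := edgeSet_subset_region Q e
  rwa [edgeSet_eq_segment] at this

theorem visible_of_visibleVertices_subset {z z' : Plane}
    (h : visibleVertices Q z' ⊆ visibleVertices Q z) :
    ∀ x ∈ range Q.vertices, segment ℝ z' x ⊆ region Q → segment ℝ z x ⊆ region Q := by
  rintro _ ⟨i, rfl⟩ hi
  exact h (show i ∈ visibleVertices Q z' from hi)

/-- All points of a uniform set are weakly visible from the same edges. -/
theorem IsSimple.weaklyVisible_of_mem (hQ : IsSimple Q) {R : Set Plane} (hR : IsUniform Q R)
    {x y : Plane} (hx : x ∈ R) (hy : y ∈ R) {e : Fin n} (hxe : WeaklyVisible Q x e) :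
    WeaklyVisible Q y e := by
  by_contra hye
  have hloc : ∀ z ∈ R, (∀ᶠ z' in 𝓝 z, z' ∈ R → WeaklyVisible Q z' e) ∨
      (∀ᶠ z' in 𝓝 z, z' ∈ R → ¬ WeaklyVisible Q z' e) := by
    intro z hz
    by_cases hze : WeaklyVisible Q z e
    · left
      filter_upwards [hQ.polygonalSet.eventually_sees_edge (hR.1 hz) ⟨e, rfl⟩ ⟨_, rfl⟩
        (hQ.vertex_ne e) (edge_subset_region Q e) (weaklyVisible_iff.1 hze)] with z' hz' hz'R
      exact weaklyVisible_iff.2 (hz' (hR.1 hz'R)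
        (visible_of_visibleVertices_subset (hR.2.2 z hz z' hz'R).le))
    · right
      rw [weaklyVisible_iff] at hze
      push Not at hze
      filter_upwards [hQ.polygonalSet.eventually_not_sees hze] with z' hz' _ hcon
      obtain ⟨u, hu, hzu⟩ := weaklyVisible_iff.1 hcon
      exact hz' u hu hzu
  obtain ⟨z, hzR, hz1, hz2⟩ := hR.2.1.isPreconnected
    {z | ∀ᶠ z' in 𝓝 z, z' ∈ R → WeaklyVisible Q z' e}
    {z | ∀ᶠ z' in 𝓝 z, z' ∈ R → ¬ WeaklyVisible Q z' e}
    isOpen_setOfPred_eventually_nhds isOpen_setOfPred_eventually_nhds hloc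
    ⟨x, hx, (hloc x hx).resolve_right fun h => h.self_of_nhds hx hxe⟩
    ⟨y, hy, (hloc y hy).resolve_left fun h => hye (h.self_of_nhds hy)⟩
  exact hz2.self_of_nhds hzR (hz1.self_of_nhds hzR)

theorem IsVisibilityRegion.closure_subset {R : Set Plane} (hR : IsVisibilityRegion Q R) :
    closure R ⊆ region Q :=
  closure_minimal hR.prop.1 (isClosed_region Q)

theorem exists_mem_mem_of_eventually {R R' : Set Plane} {p : Plane} (hp : p ∈ closure R)
    (hp' : p ∈ closure R') {F : Plane × Plane → Prop} (hF : ∀ᶠ w in 𝓝 (p, p), F w) :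
    ∃ z ∈ R, ∃ z' ∈ R', F (z, z') := by
  have h : (p, p) ∈ closure (R ×ˢ R') := by rw [closure_prod_eq]; exact ⟨hp, hp'⟩
  obtain ⟨⟨z, z'⟩, ⟨hz, hz'⟩, hw⟩ := ((mem_closure_iff_frequently.1 h).and_eventually hF).exists
  exact ⟨z, hz, z', hz', hw⟩

/-- Weak visibility from an edge passes from a region to a neighboring one that sees more
vertices. -/
theorem IsSimple.setWeaklyVisible_of_dualArc (hQ : IsSimple Q) {R R' : Set Plane}
    (h : DualArc Q R R') {e : Fin n} (he : SetWeaklyVisible Q R' e) : SetWeaklyVisible Q R e := by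
  obtain ⟨⟨hR, hR', -, a, b, hab, hs⟩, hM⟩ := h
  -- a point of the common segment that is not a vertex
  have hinf : (segment ℝ a b).Infinite := by
    rw [segment_eq_image_lineMap]
    exact (Icc_infinite zero_lt_one).image (AffineMap.lineMap_injective ℝ hab).injOn
  obtain ⟨p, hps, hpV⟩ := (hinf.sdiff (finite_range Q.vertices)).nonempty
  have hp := frontier_subset_closure (hs hps).1
  have hp' := frontier_subset_closure (hs hps).2
  obtain ⟨z, hz, z', hz', hzz'⟩ := exists_mem_mem_of_eventually hp hp'
    (hQ.polygonalSet.eventually_sees_edge_mono (hR.closure_subset hp) hpV ⟨e, rfl⟩ ⟨_, rfl⟩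
      (hQ.vertex_ne e) (edge_subset_region Q e))
  have hM' : visibleVertices Q z' ⊆ visibleVertices Q z := by
    rw [← hR.prop.visibilitySet_eq hz, ← hR'.prop.visibilitySet_eq hz']
    exact hM.subset
  have hze : WeaklyVisible Q z e := weaklyVisible_iff.2 (hzz' (hR.prop.1 hz) (hR'.prop.1 hz')
    (visible_of_visibleVertices_subset hM') (weaklyVisible_iff.1 (he z' hz')))
  exact fun y hy => hQ.weaklyVisible_of_mem hR.prop hz hy hze

theorem IsSimple.guardsPolygon_iff (hQ : IsSimple Q) (G : Finset (Fin n)) :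
    GuardsPolygon Q G ↔ CoversSinks Q (IsDualSink Q) G := by
  constructor
  · intro hG s hs
    obtain ⟨x, hx⟩ := hs.1.prop.2.1.nonempty
    obtain ⟨e, he, hxe⟩ := hG x (hs.1.prop.1 hx)
    exact ⟨e, he, fun y hy => hQ.weaklyVisible_of_mem hs.1.prop hx hy hxe⟩
  · intro hG z hz
    -- follow the arcs of the dual graph down to a sink
    have key : ∀ (M : Set (Fin n)) (R : Set Plane), IsVisibilityRegion Q R →
        visibilitySet Q R = M → ∃ e ∈ G, SetWeaklyVisible Q R e := by
      intro M
      induction M using WellFoundedLT.induction with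
      | ind M ih =>
        rintro R hR rfl
        by_cases hsink : IsDualSink Q R
        · exact hG R hsink
        · have : ∃ q, DualArc Q R q := by
            by_contra hcon
            exact hsink ⟨hR, not_exists.1 hcon⟩
          obtain ⟨q, hq⟩ := this
          obtain ⟨e, he, hqe⟩ := ih _ hq.2 q hq.1.2.1 rfl
          exact ⟨e, he, hQ.setWeaklyVisible_of_dualArc hq hqe⟩
    obtain ⟨R, hR, hzR⟩ := exists_visibilityRegion hz
    obtain ⟨e, he, hRe⟩ := key _ R hR rfl
    exact ⟨e, he, hRe z hzR⟩

end Regions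

/-! ### Polygons without three collinear vertices -/

/-- If a vertex `w` is free on one side of a line through it, then points close to `p` on that
side see past `w` along the line. -/
theorem PolygonalSet.eventually_sees_past {P V : Set Plane} (hP : PolygonalSet P V)
    {φ : Plane →ᵃ[ℝ] ℝ} {p w x : Plane} (hp : φ p = 0) (hx : φ x = 0) (hpx : p ≠ x)
    (hw : w ∈ openSegment ℝ p x) (hs : segment ℝ p x ⊆ P)
    (hV : ∀ v ∈ V, v ∈ segment ℝ p x → v = w ∨ v = x)
    (hfree : ∀ᶠ q in 𝓝 w, 0 < φ q → q ∈ P) :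
    ∀ᶠ z in 𝓝 p, z ∈ P → 0 < φ z → segment ℝ z x ⊆ P := by
  obtain ⟨T, hT, hTo, hTV, hpT, hxT⟩ := exists_tube hP.finite hp hx
  have hws : w ∈ segment ℝ p x := openSegment_subset_segment _ _ _ hw
  have hwT : w ∈ T := hT.segment_subset hpT hxT hws
  have hwx : w ≠ x := by
    rintro rfl; exact hpx (right_mem_openSegment_iff.1 hw)
  have hwx' : segment ℝ w x ⊆ segment ℝ p x :=
    segment_subset_segment hws (right_mem_segment _ _ _)
  obtain ⟨τ, ⟨hτ0, hτ1⟩, hτ⟩ : ∃ τ ∈ Ioo (0 : ℝ) 1, AffineMap.lineMap p x τ = w := by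
    rw [openSegment_eq_image_lineMap] at hw; exact hw
  have hφw : φ w = 0 := by rw [← hτ, map_lineMap, hp, hx]; ring
  have hwp : segment ℝ w p ⊆ P := by
    rw [segment_symm]
    exact (segment_subset_segment (left_mem_segment _ _ _) hws).trans hs
  have hst := hP.stable w p hwp (fun v hvV hv => by
    rw [segment_symm] at hv
    rcases hV v hvV (segment_subset_segment (left_mem_segment _ _ _) hws hv) with h | h
    · exact h
    · obtain ⟨s, hs0, hs1, hvs⟩ := mem_segment_iff_lineMap.1 hv
      rw [h, ← hτ, AffineMap.lineMap_lineMap_right, eq_comm,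
        AffineMap.lineMap_eq_right_iff] at hvs
      rcases hvs with h1 | h1
      · exact absurd h1 hpx
      · nlinarith)
  filter_upwards [hst, hTo.mem_nhds hpT] with z hz hzT hzP hφz
  obtain ⟨s, hs0, hs1, hzg⟩ := hP.exists_sees_beyond hT hTV hzT hwT hxT hφw hφz hx.ge
    (by rw [segment_symm]; exact hz hzP) (hwx'.trans hs) hφw hφz.le hx.ge (Or.inl hφz) hfree
  have hgs := lineMap_mem_segment w x hs0.le hs1.le
  have hgx : segment ℝ (AffineMap.lineMap w x s) x ⊆ segment ℝ w x :=
    segment_subset_segment hgs (right_mem_segment _ _ _)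
  refine hP.rotate hzg (hgx.trans (hwx'.trans hs)) ?_
  intro t ht0 ht1 _ v hvV hv
  exfalso
  -- a vertex on this sight line is its end, which lies strictly between `w` and `x`
  set y : Plane := AffineMap.lineMap (AffineMap.lineMap w x s) x t with hy
  have hys : y ∈ segment ℝ w x := hgx (lineMap_mem_segment _ _ ht0 ht1.le)
  have hyT : y ∈ T := hT.segment_subset hwT hxT hys
  have hφy : φ y = 0 := by
    obtain ⟨r, -, -, hr⟩ := mem_segment_iff_lineMap.1 hys
    rw [hr, map_lineMap, hφw, hx]; ring
  have hφv := hTV v hvV (hT.segment_subset hzT hyT hv)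
  obtain ⟨r, hr0, hr1, hr⟩ := mem_segment_iff_lineMap.1 hv
  have hvy : v = y := by
    rw [hr, map_lineMap, hφy] at hφv
    have h1 : (1 - r) * φ z = 0 := by linarith
    have h2 : r = 1 := by
      rcases mul_eq_zero.1 h1 with h | h
      · linarith
      · exact absurd h hφz.ne'
    rw [hr, h2, AffineMap.lineMap_apply_one]
  have hyw : y = AffineMap.lineMap w x ((1 - s) * t + s) := by
    rw [hy, AffineMap.lineMap_lineMap_left]
    congr 1; ring
  rcases hV v hvV (hwx' (hvy ▸ hys)) with h | h
  · rw [hvy, hyw, AffineMap.lineMap_eq_left_iff] at h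
    rcases h with h | h
    · exact hwx h
    · nlinarith
  · rw [hvy, hyw, AffineMap.lineMap_eq_right_iff] at h
    rcases h with h | h
    · exact hwx h
    · nlinarith

section Generic

variable {n : ℕ} {Q : Polygon Plane n}

/-- Vertices not visible from `p` are not visible from points close to `p`. -/
theorem eventually_visibleVertices_subset (Q : Polygon Plane n) (p : Plane) :
    ∀ᶠ z in 𝓝 p, visibleVertices Q z ⊆ visibleVertices Q p := by
  have : ∀ᶠ z in 𝓝 p, ∀ i, i ∈ visibleVertices Q z → i ∈ visibleVertices Q p := by
    refine eventually_all.2 fun i => ?_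
    by_cases h : i ∈ visibleVertices Q p
    · exact Eventually.of_forall fun _ _ => h
    · have hc : IsClosed {z | segment ℝ z (Q i) ⊆ region Q} :=
        (isClosed_setOf_sees (isClosed_region Q)).preimage (Continuous.prodMk_left (Q i))
      filter_upwards [hc.isOpen_compl.mem_nhds h] with z hz hz' using absurd hz' hz
  exact this

/-- Points of the region close to `p` with the same visible vertices as `p` lie in the visibility
region of `p`. -/
theorem IsSimple.eventually_mem_region (hQ : IsSimple Q) {p : Plane} (hp : p ∈ region Q) :
    ∀ᶠ z in 𝓝 p, ∀ R, IsVisibilityRegion Q R → z ∈ R →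
      visibleVertices Q z = visibleVertices Q p → p ∈ R := by
  obtain ⟨r, hr, hball⟩ := Metric.eventually_nhds_iff_ball.1 (eventually_visibleVertices_subset Q p)
  filter_upwards [Metric.ball_mem_nhds p hr, region_star Q hp] with z hz hstar R hR hzR hM
  have hzp := hstar (hR.prop.1 hzR)
  have hun : ∀ y ∈ segment ℝ z p, visibleVertices Q y = visibleVertices Q p := by
    intro y hy
    refine Subset.antisymm (hball y ((convex_ball p r).segment_subset hz
      (Metric.mem_ball_self hr) hy)) fun i hi => ?_
    have hzi : i ∈ visibleVertices Q z := hM ▸ hi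
    have h1 : segment ℝ (Q i) z ⊆ region Q := by rw [segment_symm]; exact hzi
    have h2 : segment ℝ (Q i) p ⊆ region Q := by rw [segment_symm]; exact hi
    have h3 := hQ.polygonalSet.sees_of_triangle h1 h2 hzp hy
    rw [segment_symm] at h3
    exact h3
  refine hR.subset ⟨hzp, ⟨⟨z, left_mem_segment _ _ _⟩, (convex_segment z p).isPreconnected⟩,
    fun y hy y' hy' => (hun y hy).trans (hun y' hy').symm⟩ ⟨z, hzR, left_mem_segment _ _ _⟩
    (right_mem_segment _ _ _)

/-- A segment contains a point that is no vertex and lies on a line through two vertices only if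
that line contains the segment. -/
theorem IsSimple.exists_generic (hQ : IsSimple Q) {a b : Plane} (hab : a ≠ b) :
    ∃ p ∈ segment ℝ a b, p ∉ range Q.vertices ∧ ∀ i j, i ≠ j →
      sideMap (Q i) (Q j - Q i) p = 0 →
      sideMap a (b - a) (Q i) = 0 ∧ sideMap a (b - a) (Q j) = 0 := by
  let bad : Fin n × Fin n → Set ℝ := fun k =>
    {t | sideMap (Q k.1) (Q k.2 - Q k.1) (AffineMap.lineMap a b t) = 0 ∧
      ¬ (sideMap (Q k.1) (Q k.2 - Q k.1) a = 0 ∧ sideMap (Q k.1) (Q k.2 - Q k.1) b = 0)}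
  have hbad : ∀ k, (bad k).Finite := by
    intro k
    refine Set.Subsingleton.finite ?_
    rintro s ⟨hs, hne⟩ t ⟨ht, -⟩
    rw [map_lineMap] at hs ht
    by_contra hst
    apply hne
    have h1 : (s - t) * (sideMap (Q k.1) (Q k.2 - Q k.1) b -
        sideMap (Q k.1) (Q k.2 - Q k.1) a) = 0 := by linear_combination hs - ht
    have h2 := (mul_eq_zero.1 h1).resolve_left (sub_ne_zero.2 hst)
    constructor
    · linear_combination hs - s * h2
    · linear_combination hs + (1 - s) * h2
  have hvert : ∀ i, {t : ℝ | (AffineMap.lineMap a b t : Plane) = Q i}.Finite := fun i =>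
    Set.Subsingleton.finite fun s hs t ht =>
      AffineMap.lineMap_injective ℝ hab (Eq.trans hs ht.symm)
  have hfin : ((⋃ k, bad k) ∪ ⋃ i, {t : ℝ | (AffineMap.lineMap a b t : Plane) = Q i}).Finite :=
    (finite_iUnion hbad).union (finite_iUnion hvert)
  obtain ⟨t, ht, htn⟩ := ((Icc_infinite (zero_lt_one (α := ℝ))).sdiff hfin).nonempty
  refine ⟨AffineMap.lineMap a b t, lineMap_mem_segment a b ht.1 ht.2, ?_, ?_⟩
  · rintro ⟨i, hi⟩
    exact htn (Or.inr (mem_iUnion.2 ⟨i, hi.symm⟩))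
  · intro i j hij h0
    have h1 : sideMap (Q i) (Q j - Q i) a = 0 ∧ sideMap (Q i) (Q j - Q i) b = 0 := by
      by_contra hcon
      exact htn (Or.inl (mem_iUnion.2 ⟨(i, j), h0, hcon⟩))
    have hd : Q j - Q i ≠ 0 := sub_ne_zero.2 fun h => hij (hQ.injective h).symm
    obtain ⟨s, hs⟩ := eq_add_smul_of_sideMap_eq_zero hd h1.1
    obtain ⟨s', hs'⟩ := eq_add_smul_of_sideMap_eq_zero hd h1.2
    constructor
    · rw [sideMap_apply, hs', hs]
      simp only [PiLp.add_apply, PiLp.smul_apply, PiLp.sub_apply, smul_eq_mul]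
      ring
    · rw [sideMap_apply, hs', hs]
      simp only [PiLp.add_apply, PiLp.smul_apply, PiLp.sub_apply, smul_eq_mul]
      ring

/-- Without three collinear vertices, a line contains at most two vertices. -/
theorem NoThreeCollinear.eq_or_eq (h : NoThreeCollinear Q) {a b : Plane} (hab : a ≠ b)
    {i j k : Fin n} (hjk : j ≠ k) (hi : sideMap a (b - a) (Q i) = 0)
    (hj : sideMap a (b - a) (Q j) = 0) (hk : sideMap a (b - a) (Q k) = 0) : i = j ∨ i = k := by
  by_contra hcon
  push Not at hcon
  refine h i j k hcon.1 hjk hcon.2 ?_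
  rw [collinear_iff_exists_forall_eq_smul_vadd]
  refine ⟨a, b - a, ?_⟩
  have hd : b - a ≠ 0 := sub_ne_zero.2 hab.symm
  rintro x (rfl | rfl | rfl)
  · obtain ⟨t, ht⟩ := eq_add_smul_of_sideMap_eq_zero hd hi
    exact ⟨t, by rw [ht, vadd_eq_add, add_comm]⟩
  · obtain ⟨t, ht⟩ := eq_add_smul_of_sideMap_eq_zero hd hj
    exact ⟨t, by rw [ht, vadd_eq_add, add_comm]⟩
  · obtain ⟨t, ht⟩ := eq_add_smul_of_sideMap_eq_zero hd hk
    exact ⟨t, by rw [ht, vadd_eq_add, add_comm]⟩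

/-- A vertex visible from `p` without another vertex in between is visible from all points of the
region close to `p`. -/
theorem IsSimple.eventually_visible (hQ : IsSimple Q) {p : Plane} {i : Fin n}
    (hi : i ∈ visibleVertices Q p) (hV : ∀ j, Q j ∈ segment ℝ p (Q i) → j = i) :
    ∀ᶠ z in 𝓝 p, z ∈ region Q → i ∈ visibleVertices Q z := by
  have h1 : segment ℝ (Q i) p ⊆ region Q := by rw [segment_symm]; exact hi
  filter_upwards [hQ.region_stable h1 (by
    rintro _ ⟨j, rfl⟩ hj
    rw [segment_symm] at hj
    exact congrArg Q (hV j hj))] with z hz hzP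
  have h2 := hz hzP
  rw [segment_symm] at h2
  exact h2

theorem sideMap_eq_zero_of_mem_segment {x y p : Plane} (hy : y ∈ segment ℝ p x) (hyx : y ≠ x) :
    sideMap x (y - x) p = 0 := by
  obtain ⟨t, -, -, ht⟩ := mem_segment_iff_lineMap.1 hy
  have h1 : sideMap x (y - x) y = 0 := sideMap_sub_self _ _
  have h2 : (1 - t) * sideMap x (y - x) p = 0 := by
    have h3 : sideMap x (y - x) (AffineMap.lineMap p x t) = 0 := by rw [← ht, h1]
    rw [map_lineMap, sideMap_self] at h3
    linarith
  rcases mul_eq_zero.1 h2 with h | h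
  · have : t = 1 := by linarith
    rw [this, AffineMap.lineMap_apply_one] at ht
    exact absurd ht hyx
  · exact h

/-- Near a point `p` from which the vertex `Q k` is visible past `Q j`, with no other vertex on the
segment: one closed side of the line, `ψ ≥ 0`, sees `Q k` throughout, and the other side sees `Q k`
either throughout or not at all. -/
theorem IsSimple.eventually_visible_past (hQ : IsSimple Q) {φ : Plane →ᵃ[ℝ] ℝ} {p d : Plane}
    {j k : Fin n} (hp : φ p = 0) (hk : φ (Q k) = 0) (hd : φ d ≠ 0)
    (hj : Q j ∈ openSegment ℝ p (Q k)) (hpk : p ≠ Q k) (hs : segment ℝ p (Q k) ⊆ region Q)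
    (hV : ∀ i, Q i ∈ segment ℝ p (Q k) → i = j ∨ i = k) (hint : region Q ∈ 𝓝 p) :
    ∃ ψ : Plane →ᵃ[ℝ] ℝ, (∀ᶠ z in 𝓝 p, 0 ≤ ψ z → k ∈ visibleVertices Q z) ∧
      ((∀ᶠ z in 𝓝 p, ψ z < 0 → k ∈ visibleVertices Q z) ∨
        ∀ᶠ z in 𝓝 p, ψ z < 0 → k ∉ visibleVertices Q z) := by
  have hP := hQ.polygonalSet
  have hjs : Q j ∈ segment ℝ p (Q k) := openSegment_subset_segment _ _ _ hj
  have hVr : ∀ v ∈ range Q.vertices, v ∈ segment ℝ p (Q k) → v = Q j ∨ v = Q k := by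
    rintro _ ⟨i, rfl⟩ hi
    exact (hV i hi).imp (congrArg Q) (congrArg Q)
  -- a point off the line that sees `Q j`
  have hjp : segment ℝ (Q j) p ⊆ region Q := by
    rw [segment_symm]
    exact (segment_subset_segment (left_mem_segment _ _ _) hjs).trans hs
  obtain ⟨w₀, hw₀, hφw₀⟩ : ∃ w₀, segment ℝ (Q j) w₀ ⊆ region Q ∧ φ w₀ ≠ 0 := by
    have hst := hQ.region_stable hjp (by
      rintro _ ⟨i, rfl⟩ hi
      rw [segment_symm] at hi
      rcases hV i (segment_subset_segment (left_mem_segment _ _ _) hjs hi) with h | h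
      · exact congrArg Q h
      · rw [h] at hi
        obtain ⟨τ, ⟨hτ0, hτ1⟩, hτ⟩ : ∃ τ ∈ Ioo (0 : ℝ) 1, AffineMap.lineMap p (Q k) τ = Q j := by
          rw [openSegment_eq_image_lineMap] at hj; exact hj
        obtain ⟨s, hs0, hs1, hvs⟩ := mem_segment_iff_lineMap.1 hi
        rw [← hτ, AffineMap.lineMap_lineMap_right, eq_comm, AffineMap.lineMap_eq_right_iff] at hvs
        rcases hvs with h1 | h1
        · exact absurd h1 hpk
        · nlinarith)
    obtain ⟨s, ⟨hs1, hs2⟩, hs0, -⟩ := (((eventually_lineMap_mem (b := d) hst).and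
      (eventually_lineMap_mem (b := d) hint)).and eventually_pos_lt_one).exists
    refine ⟨_, hs1 hs2, ?_⟩
    rw [map_lineMap, hp, mul_zero, zero_add]
    exact mul_ne_zero hs0.ne' hd
  -- each side of which one point sees `Q k` is free at `Q j`
  have hback : ∀ ψ : Plane →ᵃ[ℝ] ℝ, ψ p = 0 → ψ (Q k) = 0 →
      (∀ᶠ z in 𝓝 p, 0 < ψ z → k ∈ visibleVertices Q z) ∨
        ∀ᶠ z in 𝓝 p, 0 < ψ z → k ∉ visibleVertices Q z := by
    intro ψ hψp hψk
    rw [or_iff_not_imp_left]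
    intro hcon
    filter_upwards [region_star Q (hjp (right_mem_segment _ _ _))] with y hstar hy hky
    apply hcon
    have hyP : y ∈ region Q := hky (left_mem_segment _ _ _)
    have htri : convexHull ℝ {p, y, Q k} ⊆ region Q := by
      refine hP.triangle _ _ _ ?_ hs hky
      rw [segment_symm]
      exact hstar hyP
    have hfree : ∀ᶠ q in 𝓝 (Q j), 0 < ψ q → q ∈ region Q := by
      filter_upwards [eventually_mem_triangle hψp hψk hy hpk hj] with q hq hq0
      exact htri (hq hq0.le)
    filter_upwards [hP.eventually_sees_past hψp hψk hpk hj hs hVr hfree, hint] with z hz hzP hz0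
    exact hz hzP hz0
  have hnonneg : ∀ ψ : Plane →ᵃ[ℝ] ℝ, (∀ z, ψ z = 0 ↔ φ z = 0) →
      (∀ᶠ q in 𝓝 (Q j), 0 < ψ q → q ∈ region Q) →
      ∀ᶠ z in 𝓝 p, 0 ≤ ψ z → k ∈ visibleVertices Q z := by
    intro ψ hψ hfree
    have hψp := (hψ p).2 hp
    have hψk := (hψ _).2 hk
    have hψd : ψ d ≠ 0 := fun h => hd ((hψ d).1 h)
    have hlt : ∀ᶠ z in 𝓝 p, (∃ t : ℝ, z = AffineMap.lineMap p (Q k) t) →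
        z ∈ region Q → segment ℝ z (Q k) ⊆ region Q := by
      -- the points of the line close to `p` lie on the near side of `Q k`
      filter_upwards [region_star Q (hjp (right_mem_segment _ _ _)),
        Metric.ball_mem_nhds p (dist_pos.2 hpk)] with z hstar hzb
      rintro ⟨t, rfl⟩ hzP
      have hzp := hstar hzP
      rcases le_total 0 t with h0 | h0
      · have h1 : t ≤ 1 := by
          rw [Metric.mem_ball, dist_lineMap_left, Real.norm_eq_abs] at hzb
          have h2 := dist_pos.2 hpk
          by_contra hcon
          push Not at hcon
          rw [abs_of_nonneg h0] at hzb
          nlinarith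
        exact (segment_subset_segment (lineMap_mem_segment _ _ h0 h1)
          (right_mem_segment _ _ _)).trans hs
      · refine sees_of_mem ?_ hzp hs
        refine mem_segment_iff_lineMap.2 ⟨-t / (1 - t), div_nonneg (by linarith) (by linarith),
          (div_le_one (by linarith)).2 (by linarith), ?_⟩
        rw [AffineMap.lineMap_lineMap_left]
        have h1 : (1 - t) ≠ 0 := by linarith
        have h2 : 1 - (1 - -t / (1 - t)) * (1 - t) = 0 := by field_simp; ring
        rw [h2, AffineMap.lineMap_apply_zero]
    filter_upwards [hP.eventually_sees_past hψp hψk hpk hj hs hVr hfree, hint, hlt]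
      with z hz hzP hzl hz0
    rcases eq_or_lt_of_le hz0 with h | h
    · exact hzl (exists_lineMap_of_eq_zero hpk hψp hψk hψd h.symm) hzP
    · exact hz hzP h
  rcases hP.oneSide (Q j) ⟨j, rfl⟩ φ p (Q k) w₀ hj hpk hs hp hk hw₀ hφw₀ with hfree | hfree
  · refine ⟨φ, hnonneg φ (fun _ => Iff.rfl) hfree, ?_⟩
    simpa using hback (-φ) (by simp [hp]) (by simp [hk])
  · refine ⟨-φ, hnonneg (-φ) (fun z => by simp) (by simpa using hfree), ?_⟩
    simpa using hback φ hp hk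

/-- Without three collinear vertices, of two neighboring visibility regions one sees strictly fewer
vertices than the other. -/
theorem IsSimple.ssubset_or_ssubset (hQ : IsSimple Q) (hnc : NoThreeCollinear Q) {R R' : Set Plane}
    (h : Neighboring Q R R') : visibilitySet Q R' ⊂ visibilitySet Q R ∨
      visibilitySet Q R ⊂ visibilitySet Q R' := by
  obtain ⟨hR, hR', hne, a, b, hab, hs⟩ := h
  obtain ⟨p, hps, hpV, hgen⟩ := hQ.exists_generic hab
  have hpc := frontier_subset_closure (hs hps).1
  have hpc' := frontier_subset_closure (hs hps).2
  have hpP := hR.closure_subset hpc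
  set φ := sideMap a (b - a) with hφ
  have hφp : φ p = 0 := by
    obtain ⟨t, -, -, rfl⟩ := mem_segment_iff_lineMap.1 hps
    rw [map_lineMap, hφ, sideMap_self, sideMap_sub_self]; ring
  -- a visible vertex with another vertex in between lies on the common segment's line
  have hon : ∀ i j, Q j ∈ segment ℝ p (Q i) → j ≠ i → φ (Q i) = 0 ∧ φ (Q j) = 0 := by
    intro i j hj hji
    exact hgen i j hji.symm (sideMap_eq_zero_of_mem_segment hj fun h => hji (hQ.injective h))
  have t1 : Tendsto (fun w : Plane × Plane => w.1) (𝓝 (p, p)) (𝓝 p) :=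
    continuous_fst.tendsto (p, p)
  have t2 : Tendsto (fun w : Plane × Plane => w.2) (𝓝 (p, p)) (𝓝 p) :=
    continuous_snd.tendsto (p, p)
  have evsub := eventually_visibleVertices_subset Q p
  have evreg := hQ.eventually_mem_region hpP
  by_cases hcase : ∃ j k, k ∈ visibleVertices Q p ∧ Q j ∈ segment ℝ p (Q k) ∧ j ≠ k
  · obtain ⟨j, k, hk, hj, hjk⟩ := hcase
    obtain ⟨hφk, hφj⟩ := hon k j hj hjk
    have hQjk : Q j ≠ Q k := fun h => hjk (hQ.injective h)
    have hpj : p ≠ Q j := fun h => hpV ⟨j, h.symm⟩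
    have hpk : p ≠ Q k := fun h => hpV ⟨k, h.symm⟩
    have hjo : Q j ∈ openSegment ℝ p (Q k) :=
      mem_openSegment_of_ne_left_right hpj hQjk.symm hj
    have honly : ∀ i, φ (Q i) = 0 → i = j ∨ i = k := fun i hi => hnc.eq_or_eq hab hjk hi hφj hφk
    obtain ⟨τ, ⟨hτ0, hτ1⟩, hτ⟩ : ∃ τ ∈ Ioo (0 : ℝ) 1, AffineMap.lineMap p (Q k) τ = Q j := by
      have h1 := hjo
      rw [openSegment_eq_image_lineMap] at h1; exact h1
    have hkj : Q k ∉ segment ℝ p (Q j) := by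
      intro hc
      obtain ⟨s, hs0, hs1, hvs⟩ := mem_segment_iff_lineMap.1 hc
      rw [← hτ, AffineMap.lineMap_lineMap_right, eq_comm, AffineMap.lineMap_eq_right_iff] at hvs
      rcases hvs with h1 | h1
      · exact hpk h1
      · nlinarith
    -- `p` is not on the boundary, since the edge containing it would be `j k`
    have hpB : p ∉ Q.boundary ℝ := by
      intro hpB
      obtain ⟨i, hi⟩ := mem_boundary_iff.1 hpB
      rw [edgeSet_eq_segment] at hi
      have hl : sideMap (Q i) (Q (finRotate n i) - Q i) p = 0 := by
        obtain ⟨t, -, -, ht⟩ := mem_segment_iff_lineMap.1 hi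
        rw [ht, map_lineMap, sideMap_self, sideMap_sub_self]; ring
      obtain ⟨h1, h2⟩ := hgen i _ (hQ.finRotate_ne i).symm hl
      have hpjk : p ∈ segment ℝ (Q j) (Q k) := by
        rcases honly _ h1 with e1 | e1 <;> rcases honly _ h2 with e2 | e2
        · exact absurd (e2.trans e1.symm) (hQ.finRotate_ne i)
        · rwa [e2, e1] at hi
        · rwa [e2, e1, segment_symm] at hi
        · exact absurd (e2.trans e1.symm) (hQ.finRotate_ne i)
      obtain ⟨s, hs0, hs1, hps'⟩ := mem_segment_iff_lineMap.1 hpjk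
      rw [← hτ, AffineMap.lineMap_lineMap_left, eq_comm, AffineMap.lineMap_eq_left_iff] at hps'
      rcases hps' with h3 | h3
      · exact hpk h3
      · nlinarith
    have hint := region_mem_nhds hpP hpB
    obtain ⟨d, hd⟩ : ∃ d, φ d ≠ 0 := by
      have h3 := hQ.three_le
      by_contra hcon
      push Not at hcon
      have hall : ∀ i, i = j ∨ i = k := fun i => honly i (hcon _)
      have hsub : (Finset.univ : Finset (Fin n)) ⊆ {j, k} := fun i _ => by
        simpa using hall i
      have h4 := Finset.card_le_card hsub
      have h5 := Finset.card_le_two (a := j) (b := k)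
      simp only [Finset.card_univ, Fintype.card_fin] at h4
      omega
    obtain ⟨ψ, hψ1, hψ2⟩ := hQ.eventually_visible_past hφp hφk hd hjo hpk hk
      (fun i hi => by
        by_cases hik : i = k
        · exact Or.inr hik
        · exact honly i (hon k i hi hik).2) hint
    -- all other vertices visible from `p` remain visible
    have evoth : ∀ᶠ z in 𝓝 p, ∀ i, i ≠ k → i ∈ visibleVertices Q p → i ∈ visibleVertices Q z := by
      refine eventually_all.2 fun i => ?_
      by_cases hi : i ≠ k ∧ i ∈ visibleVertices Q p
      · have hV : ∀ l, Q l ∈ segment ℝ p (Q i) → l = i := by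
          intro l hl
          by_contra hli
          obtain ⟨h1, h2⟩ := hon i l hl hli
          have hij : i = j := (honly i h1).resolve_right hi.1
          have hlk : l = k := (honly l h2).resolve_left fun h => hli (h.trans hij.symm)
          rw [hij, hlk] at hl
          exact hkj hl
        filter_upwards [hQ.eventually_visible hi.2 hV, hint] with z hz hzP _ _ using hz hzP
      · exact Eventually.of_forall fun z h1 h2 => absurd ⟨h1, h2⟩ hi
    obtain ⟨σ, hσ⟩ : ∃ σ : Prop, ∀ᶠ z in 𝓝 p, ψ z < 0 → (k ∈ visibleVertices Q z ↔ σ) := by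
      rcases hψ2 with h | h
      · exact ⟨True, h.mono fun z hz h0 => iff_true_intro (hz h0)⟩
      · exact ⟨False, h.mono fun z hz h0 => iff_false_intro (hz h0)⟩
    obtain ⟨r, hr, hball⟩ := Metric.eventually_nhds_iff_ball.1
      (((evsub.and evreg).and (evoth.and hint)).and (hψ1.and hσ))
    obtain ⟨z, hz, hzr⟩ := Metric.mem_closure_iff.1 hpc r hr
    obtain ⟨z', hz', hzr'⟩ := Metric.mem_closure_iff.1 hpc' r hr
    have hzb : z ∈ Metric.ball p r := by rwa [Metric.mem_ball, dist_comm]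
    have hzb' : z' ∈ Metric.ball p r := by rwa [Metric.mem_ball, dist_comm]
    have hfull : ∀ y ∈ Metric.ball p r, k ∈ visibleVertices Q y →
        visibleVertices Q y = visibleVertices Q p := by
      intro y hy hky
      obtain ⟨⟨⟨h1, -⟩, h2, -⟩, -⟩ := hball y hy
      refine Subset.antisymm h1 fun i hi => ?_
      by_cases hik : i = k
      · rwa [hik]
      · exact h2 i hik hi
    have hless : ∀ y ∈ Metric.ball p r, k ∉ visibleVertices Q y →
        visibleVertices Q y = visibleVertices Q p \ {k} := by
      intro y hy hky
      obtain ⟨⟨⟨h1, -⟩, h2, -⟩, -⟩ := hball y hy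
      refine Subset.antisymm (fun i hi => ⟨h1 hi, fun hik => hky (hik ▸ hi)⟩) fun i hi => ?_
      exact h2 i hi.2 hi.1
    have hss : visibleVertices Q p \ {k} ⊂ visibleVertices Q p :=
      ⟨sdiff_subset, fun hcon => (hcon hk).2 rfl⟩
    rw [hR.prop.visibilitySet_eq hz, hR'.prop.visibilitySet_eq hz']
    by_cases hkz : k ∈ visibleVertices Q z <;> by_cases hkz' : k ∈ visibleVertices Q z'
    · exact absurd (hR.eq hR' ⟨p, (hball z hzb).1.1.2 R hR hz (hfull z hzb hkz),
        (hball z' hzb').1.1.2 R' hR' hz' (hfull z' hzb' hkz')⟩) hne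
    · left
      rw [hfull z hzb hkz, hless z' hzb' hkz']
      exact hss
    · right
      rw [hfull z' hzb' hkz', hless z hzb hkz]
      exact hss
    · -- both points lie on the obstructed side, where the segment between them is uniform
      exfalso
      have hψz : ψ z < 0 := not_le.1 fun h => hkz ((hball z hzb).2.1 h)
      have hψz' : ψ z' < 0 := not_le.1 fun h => hkz' ((hball z' hzb').2.1 h)
      have hun : ∀ y ∈ segment ℝ z z', y ∈ region Q ∧
          visibleVertices Q y = visibleVertices Q p \ {k} := by
        intro y hy
        have hyb := (convex_ball p r).segment_subset hzb hzb' hy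
        have hψy : ψ y < 0 :=
          ((convex_Iio (0 : ℝ)).affine_preimage ψ).segment_subset hψz hψz' hy
        have hky : k ∉ visibleVertices Q y := fun h =>
          hkz (((hball z hzb).2.2 hψz).2 (((hball y hyb).2.2 hψy).1 h))
        exact ⟨(hball y hyb).1.2.2, hless y hyb hky⟩
      have hU : IsUniform Q (segment ℝ z z') :=
        ⟨fun y hy => (hun y hy).1,
          ⟨⟨z, left_mem_segment _ _ _⟩, (convex_segment z z').isPreconnected⟩,
          fun y hy y' hy' => (hun y hy).2.trans (hun y' hy').2.symm⟩
      exact hne (hR.eq hR' ⟨z', hR.subset hU ⟨z, hz, left_mem_segment _ _ _⟩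
        (right_mem_segment _ _ _), hz'⟩)
  · push Not at hcase
    exfalso
    have evall : ∀ᶠ z in 𝓝 p, z ∈ region Q → visibleVertices Q z = visibleVertices Q p := by
      have : ∀ᶠ z in 𝓝 p, ∀ i, i ∈ visibleVertices Q p → z ∈ region Q →
          i ∈ visibleVertices Q z := by
        refine eventually_all.2 fun i => ?_
        by_cases hi : i ∈ visibleVertices Q p
        · filter_upwards [hQ.eventually_visible hi (fun j hj => hcase j i hi hj)] with z hz _
            using hz
        · exact Eventually.of_forall fun z h1 => absurd h1 hi
      filter_upwards [this, evsub] with z h1 h2 hzP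
      exact Subset.antisymm h2 fun i hi => h1 i hi hzP
    obtain ⟨z, hz, z', hz', ⟨h1, h2⟩, h3, h4⟩ := exists_mem_mem_of_eventually hpc hpc'
      (((t1.eventually evreg).and (t2.eventually evreg)).and
        ((t1.eventually evall).and (t2.eventually evall)))
    exact hne (hR.eq hR' ⟨p, h1 R hR hz (h3 (hR.prop.1 hz)), h2 R' hR' hz' (h4 (hR'.prop.1 hz'))⟩)

theorem IsSimple.isDualSink_eq (hQ : IsSimple Q) (hnc : NoThreeCollinear Q) :
    IsDualSink Q = IsStrictSink Q := by
  funext s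
  apply propext
  constructor
  · rintro ⟨hs, h⟩
    exact ⟨hs, fun q hq => (hQ.ssubset_or_ssubset hnc hq).resolve_left fun h' => h q ⟨hq, h'⟩⟩
  · rintro ⟨hs, h⟩
    exact ⟨hs, fun q hq => (h q hq.1).not_subset hq.2.subset⟩

end Generic

end EdgeGuard

theorem lemma3p2 {n : ℕ} (Q : Polygon EdgeGuard.Plane n) (hQ : EdgeGuard.IsSimple Q)
    (G : Finset (Fin n)) :
    (EdgeGuard.IsOptimalEdgeGuardSet Q G ↔
      EdgeGuard.IsMinimum (EdgeGuard.CoversSinks Q (EdgeGuard.IsDualSink Q)) G) ∧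
    (EdgeGuard.NoThreeCollinear Q →
      (EdgeGuard.IsOptimalEdgeGuardSet Q G ↔
        EdgeGuard.IsMinimum (EdgeGuard.CoversSinks Q (EdgeGuard.IsStrictSink Q)) G)) := by
  have h : EdgeGuard.GuardsPolygon Q = EdgeGuard.CoversSinks Q (EdgeGuard.IsDualSink Q) :=
    funext fun H => propext (hQ.guardsPolygon_iff H)
  refine ⟨?_, fun hnc => ?_⟩
  · rw [EdgeGuard.IsOptimalEdgeGuardSet, h]
  · rw [EdgeGuard.IsOptimalEdgeGuardSet, h, hQ.isDualSink_eq hnc]
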